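/- Let $d\ge 2$, let $\mathcal M^d$ be the set of probability vectors on the nearest neighbours $\{\pm e_i\}_{i=1}^d$ of the origin, let $\nu$ be a probability measure on $\mathcal M^d$ and let $P=\nu^{\mathbb Z^d}$ be the i.i.d. law on environments $\omega=(\omega(z,e))$. Assume that $P$-almost surely $\omega$ is balanced, i.e. $\omega(z,e)=\omega(z,-e)$ for all $z,e$, and genuinely $d$-dimensional, i.e. for every $e\in\{\pm e_i\}$ there is $z\in\mathbb Z^d$ with $\omega(z,e)>0$. For an environment $\omega$ let $P^z_\omega$ be the law of the Markov chain $(X_n)$ on $\mathbb Z^d$ started at $z$ that jumps from $x$ to $x+e$ with probability $\omega(x,e)$. *Rescaled walk.* Put $T_0=0$, let $T_{k+1}\in\mathbb N\cup\{\infty\}$ be the first time $t>T_k$ such that each of the $d$ coordinates has changed in at least one of the steps $T_k+1,\dots,t$ of $X$, and let $Y_k=X_{T_k}$. *Reflected-periodized environment.* For $N\ge1$ let $\Delta_N=[0,N)^d\cap\mathbb Z^d$, let $f:\mathbb Z^d\to\Delta_N$ be given coordinatewise by $x\mapsto\min\big(x \bmod 2N,\ 2N-1-(x\bmod 2N)\big)$,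 and put $\omega^{(N)}(z)=\omega(f(z))$. Let $P_N$ be the uniform distribution on $\Delta_N$. A probability measure $H$ on $\Delta_N$ is called stationary (for $\omega$ and $N$) if it is stationary for the Markov chain $(f(Y_n))_n$ on $\Delta_N$, where $Y$ is the rescaled walk in the environment $\omega^{(N)}$; that is, $$\sum_{x\in\Delta_N}H(x)\,P^x_{\omega^{(N)}}\big(T_1<\infty,\ f(Y_1)=y\big)=H(y)\qquad (y\in\Delta_N).$$ **Lemma.** For $P$-almost every $\omega$ and all $N$ large enough, the rescaled walk under $\omega^{(N)}$ is well defined (for every starting point $z\in\mathbb Z^d$, $P^z_{\omega^{(N)}}$-almost surely $T_k<\infty$ for all $k$) and a stationary probability measure on $\Delta_N$ exists. Moreover, put $p=\frac d{d-1}$. There is a constant $C<\infty$, depending only on $d$ and $\nu$, such that for $P$-almost every $\omega$ and for every choice of stationary probability measures $H_N=H_N(\omega)$ on $\Delta_N$ (for all sufficiently large $N$), with densities $\Phi_N=\frac{dH_N}{dP_N}$, $$\limsup_{N\to\infty}\ \|\Phi_N\|_{\Delta_N,p}\ \le\ C,\qquad\text{where}\quad \|g\|_{\Delta_N,p}=\Big(\frac1{|\Delta_N|}\sum_{z\in\Delta_N}|g(z)|^p\Big)^{1/p}.$$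 -/

import Mathlib

open MeasureTheory ProbabilityTheory Filter
open scoped ENNReal NNReal

namespace BalancedRWRE

/-- The lattice `ℤ^d`. -/
abbrev Lattice (d : ℕ) : Type := Fin d → ℤ

/-- The `2d` nearest neighbours of the origin; `(i, s)` with a sign `s` stands for `s e_i`. -/
abbrev Dir (d : ℕ) : Type := Fin d × ℤˣ

/-- The lattice vector `± e_i`. -/
def Dir.vec {d : ℕ} (e : Dir d) : Lattice d := Pi.single e.1 (e.2 : ℤ)

/-- The direction `-e`. -/
def Dir.neg {d : ℕ} (e : Dir d) : Dir d := (e.1, -e.2)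

/-- The space of all probability vectors on the nearest neighbours of the origin. -/
abbrev LocalEnv (d : ℕ) : Type := stdSimplex ℝ (Dir d)

/-- Environments: `ω z e` is the probability of a jump from `z` to `z + e`. -/
abbrev Env (d : ℕ) : Type := Lattice d → LocalEnv d

/-- The i.i.d. law `ν^{ℤ^d}` on environments. -/
noncomputable def envLaw {d : ℕ} (ν : Measure (LocalEnv d)) [IsProbabilityMeasure ν] :
    Measure (Env d) :=
  Measure.infinitePi (fun _ : Lattice d => ν)

/-- `ω(z, e) = ω(z, -e)` for all `z` and `e`. -/
def IsBalanced {d : ℕ} (ω : Env d) : Prop :=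
  ∀ (z : Lattice d) (e : Dir d), (ω z).1 e = (ω z).1 e.neg

/-- Every direction is used with positive probability at some site. -/
def IsGenuinelyDDimensional {d : ℕ} (ω : Env d) : Prop :=
  ∀ e : Dir d, ∃ z : Lattice d, 0 < (ω z).1 e

/-- The law of one step of the walk from `z`. -/
noncomputable def stepMeasure {d : ℕ} (ω : Env d) (z : Lattice d) : Measure (Lattice d) :=
  ∑ e : Dir d, ENNReal.ofReal ((ω z).1 e) • Measure.dirac (z + e.vec)

instance instIsProbabilityMeasureStepMeasure {d : ℕ} (ω : Env d) (z : Lattice d) :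
    IsProbabilityMeasure (stepMeasure ω z) := by
  constructor
  simp only [stepMeasure, Measure.coe_finsetSum, Finset.sum_apply, Measure.smul_apply,
    measure_univ, smul_eq_mul, mul_one]
  rw [← ENNReal.ofReal_sum_of_nonneg fun e _ => (ω z).2.1 e, (ω z).2.2, ENNReal.ofReal_one]

/-- The transition kernel of the walk in the environment `ω`. -/
noncomputable def stepKernel {d : ℕ} (ω : Env d) : Kernel (Lattice d) (Lattice d) :=
  Kernel.ofFunOfCountable (stepMeasure ω)

instance instIsMarkovKernelStepKernel {d : ℕ} (ω : Env d) : IsMarkovKernel (stepKernel ω) :=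
  ⟨fun z => instIsProbabilityMeasureStepMeasure ω z⟩

/-- The transition kernel at time `n`, as a function of the whole past: it only looks at the
present position. -/
noncomputable def historyKernel {d : ℕ} (ω : Env d) (n : ℕ) :
    Kernel ((i : Finset.Iic n) → (fun _ : ℕ => Lattice d) i) (Lattice d) :=
  (stepKernel ω).comap (fun x => x ⟨n, Finset.mem_Iic.2 le_rfl⟩) (measurable_pi_apply _)

instance instIsMarkovKernelHistoryKernel {d : ℕ} (ω : Env d) (n : ℕ) :
    IsMarkovKernel (historyKernel ω n) := by
  unfold historyKernel
  infer_instance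

/-- The quenched law `P_ω^z`: the law on `(ℤ^d)^ℕ` of the Markov chain with kernel
`stepKernel ω` started at `z`. -/
noncomputable def quenchedLaw {d : ℕ} (ω : Env d) (z : Lattice d) : Measure (ℕ → Lattice d) :=
  Kernel.traj (X := fun _ : ℕ => Lattice d) (historyKernel ω) 0 (fun _ => z)

/-- The times `T_k`: `T_0 = 0`, and `T_{k+1}` is the first time after `T_k` by which every
coordinate has changed at least once since time `T_k` (`⊤` if there is no such time). -/
noncomputable def rescaledTime {d : ℕ} (X : ℕ → Lattice d) : ℕ → ℕ∞
  | 0 => 0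
  | k + 1 =>
    ⨅ (t : ℕ) (_ : rescaledTime X k < (t : ℕ∞) ∧
        ∀ i : Fin d, ∃ s : ℕ, rescaledTime X k < (s : ℕ∞) ∧ s ≤ t ∧ X s i ≠ X (s - 1) i),
      (t : ℕ∞)

/-- The rescaled walk `Y_k = X_{T_k}`, meaningful as long as `T_k < ⊤`. -/
noncomputable def rescaledWalk {d : ℕ} (X : ℕ → Lattice d) (k : ℕ) : Lattice d :=
  X (rescaledTime X k).toNat

/-- The folding map of `ℤ^d` onto the cube `[0, N)^d`: coordinatewise
`x ↦ min (x mod 2N) (2N - 1 - (x mod 2N))`. -/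
def fold {d : ℕ} (N : ℕ) (z : Lattice d) : Lattice d :=
  fun i => min (z i % (2 * N : ℤ)) (2 * N - 1 - z i % (2 * N : ℤ))

/-- The reflected-periodized environment `ω^{(N)}`. -/
def periodized {d : ℕ} (ω : Env d) (N : ℕ) : Env d := fun z => ω (fold N z)

/-- The cube `Δ_N = [0, N)^d` of lattice points. -/
noncomputable def cube (d N : ℕ) : Finset (Lattice d) := Fintype.piFinset fun _ => Finset.Ico (0 : ℤ) N

/-- The uniform distribution `P_N` on `Δ_N`. -/
noncomputable def uniformCube (d N : ℕ) : Measure (Lattice d) :=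
  uniformOn (cube d N : Set (Lattice d))

/-- One-step transition probabilities from `x` to `y` of the folded rescaled walk `(f(Y_n))`
under `ω^{(N)}`. -/
noncomputable def foldedTransition {d : ℕ} (ω : Env d) (N : ℕ) (x y : Lattice d) : ℝ≥0∞ :=
  quenchedLaw (periodized ω N) x {X | rescaledTime X 1 < ⊤ ∧ fold N (rescaledWalk X 1) = y}

/-- `H` is a stationary probability measure on `Δ_N` of the folded rescaled walk. -/
structure IsStationary {d : ℕ} (ω : Env d) (N : ℕ) (H : Measure (Lattice d)) : Prop where
  isProbabilityMeasure : IsProbabilityMeasure H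
  supported : H ((cube d N : Set (Lattice d))ᶜ) = 0
  stationary : ∀ y ∈ cube d N, ∑ x ∈ cube d N, H {x} * foldedTransition ω N x y = H {y}

/-- The density `Φ_N = dH / dP_N` with respect to the uniform distribution on `Δ_N`. -/
noncomputable def density {d : ℕ} (N : ℕ) (H : Measure (Lattice d)) : Lattice d → ℝ≥0∞ :=
  H.rnDeriv (uniformCube d N)

end BalancedRWRE

namespace BalancedRWRE

/-! ### The folding map -/

/-! The bound is dual to a discrete Aleksandrov–Bakelman–Pucci estimate for the transition operator
`P` of the folded rescaled walk (`foldedOp`). For `g ≥ 0` solve `u = g + (1 - N⁻²) P u`. Summing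
against a stationary `H` gives `∫ u dH = N² ∫ g dH`, so `N² ∫ g dH ≤ max u`, while
`max_resolvent_pow_le` bounds `(max u)^d` by a constant times `N^d ∑ g^d`. The choice `g =
Φ^(1/(d-1))` makes both sides powers of the norm of `Φ` (`eLpNorm_density_le`).

In the maximum principle, `u ∘ fold` is touched from above by paraboloids of opening `a` whose
slopes fill a cube of volume `(2aN)^d`. Two slopes with the same contact point `z` differ in each
coordinate by at most `2 (u - P u + a h)(z)`, where `h` dominates the expected duration of one
rescaled step (`abs_slope_sub_le`). Indeed the walk is a martingale and every coordinate has moved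
by time `T_1`, so a linear function vanishing at `z` has expected absolute value at least each of
its coefficients; this replaces ellipticity. Comparing volumes gives `pow_le_sum_contact`. The error
`a h` is absorbed by the killing `N⁻²` where `h` is moderate, and by a spatial moment of order `d +
1` where `h` is large.

The moment bound is `exists_expectedTime`. The expected time until coordinate `i` moves (`green`) is
controlled by a sum over `k` of a power of `k` times the probability `reach` of leaving the box of
radius `k` before that move, because a balanced walk leaves a box in quadratic time. Averaged over
the environment `reach` decays geometrically: each new shell is entered at an unexplored site, where
coordinate `i` has a positive mean chance to move (`integral_reach_le`). Finite-range dependence,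
Chebyshev and Borel–Cantelli turn this into spatial averages for almost every environment
(`ae_sum_reach_le`), hence into moments (`ae_sum_green_pow_le`).

Expectations are computed by the recursion `stoppedExp`, which `pathState` links to the path
measure. Existence of `H` is the existence of a stationary vector for a finite stochastic matrix. -/

lemma emod_succ_cases {m t : ℤ} (hm : 0 < m) :
    (t % m = m - 1 ∧ (t + 1) % m = 0) ∨ (t % m < m - 1 ∧ (t + 1) % m = t % m + 1) := by
  have h0 := Int.emod_nonneg t hm.ne'
  have h1 := Int.emod_lt_of_pos t hm
  have h2 : (t + 1) % m = (t % m + 1) % m := by simp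
  rcases eq_or_lt_of_le (show t % m ≤ m - 1 by lia) with h | h
  · left
    refine ⟨h, ?_⟩
    rw [h2, h, sub_add_cancel, Int.emod_self]
  · right
    refine ⟨h, ?_⟩
    rw [h2, Int.emod_eq_of_lt (by lia) (by lia)]

/-- The folding map in one coordinate. -/
def foldInt (N : ℕ) (t : ℤ) : ℤ := min (t % (2 * N : ℤ)) (2 * N - 1 - t % (2 * N : ℤ))

lemma fold_apply {d : ℕ} (N : ℕ) (z : Lattice d) (i : Fin d) : fold N z i = foldInt N (z i) := rfl

lemma foldInt_nonneg {N : ℕ} (hN : 0 < N) (t : ℤ) : 0 ≤ foldInt N t := by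
  have h0 := Int.emod_nonneg t (show (2 * N : ℤ) ≠ 0 by lia)
  have h1 := Int.emod_lt_of_pos t (show (0 : ℤ) < 2 * N by lia)
  unfold foldInt
  lia

lemma foldInt_lt {N : ℕ} (hN : 0 < N) (t : ℤ) : foldInt N t < N := by
  have h0 := Int.emod_nonneg t (show (2 * N : ℤ) ≠ 0 by lia)
  have h1 := Int.emod_lt_of_pos t (show (0 : ℤ) < 2 * N by lia)
  unfold foldInt
  lia

lemma foldInt_of_mem {N : ℕ} {t : ℤ} (h0 : 0 ≤ t) (h1 : t < N) : foldInt N t = t := by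
  have h2 : t % (2 * N : ℤ) = t := Int.emod_eq_of_lt h0 (by lia)
  unfold foldInt
  lia

/-- The reflection axes are at half-integers, so at a wall one neighbour folds back onto the point
itself. The two alternatives are the rising and the falling sheet of the fold. -/
lemma foldInt_step {N : ℕ} (hN : 0 < N) (t : ℤ) :
    (foldInt N (t + 1) = min (foldInt N t + 1) (N - 1) ∧
      foldInt N (t - 1) = max (foldInt N t - 1) 0) ∨
    (foldInt N (t + 1) = max (foldInt N t - 1) 0 ∧
      foldInt N (t - 1) = min (foldInt N t + 1) (N - 1)) := by
  have hm : (0 : ℤ) < 2 * N := by lia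
  have a := emod_succ_cases (t := t) hm
  have b := emod_succ_cases (t := t - 1) hm
  rw [sub_add_cancel] at b
  have h0 := Int.emod_nonneg t hm.ne'
  have h1 := Int.emod_lt_of_pos t hm
  have h2 := Int.emod_nonneg (t - 1) hm.ne'
  have h3 := Int.emod_nonneg (t + 1) hm.ne'
  unfold foldInt
  generalize t % (2 * N : ℤ) = r at *
  generalize (t + 1) % (2 * N : ℤ) = r1 at *
  generalize (t - 1) % (2 * N : ℤ) = r2 at *
  lia

lemma mem_cube {d N : ℕ} {x : Lattice d} : x ∈ cube d N ↔ ∀ i, 0 ≤ x i ∧ x i < N := by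
  simp [cube]

lemma fold_mem_cube {d N : ℕ} (hN : 0 < N) (x : Lattice d) : fold N x ∈ cube d N :=
  mem_cube.2 fun _ => ⟨foldInt_nonneg hN _, foldInt_lt hN _⟩

lemma fold_of_mem {d N : ℕ} {x : Lattice d} (hx : x ∈ cube d N) : fold N x = x := by
  funext i
  exact foldInt_of_mem (mem_cube.1 hx i).1 (mem_cube.1 hx i).2

lemma fold_fold {d N : ℕ} (hN : 0 < N) (x : Lattice d) : fold N (fold N x) = fold N x :=
  fold_of_mem (fold_mem_cube hN x)

lemma add_vec_apply_self {d : ℕ} (x : Lattice d) (e : Dir d) :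
    (x + e.vec) e.1 = x e.1 + (e.2 : ℤ) := by
  simp [Dir.vec]

lemma add_vec_apply_ne {d : ℕ} (x : Lattice d) (e : Dir d) {i : Fin d} (hi : i ≠ e.1) :
    (x + e.vec) i = x i := by
  simp [Dir.vec, Pi.single_eq_of_ne hi]

lemma fold_add_vec {d : ℕ} (N : ℕ) (x : Lattice d) (e : Dir d) :
    fold N (x + e.vec) = Function.update (fold N x) e.1 (foldInt N (x e.1 + (e.2 : ℤ))) := by
  funext i
  by_cases hi : i = e.1
  · subst hi
    rw [fold_apply, add_vec_apply_self, Function.update_self]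
  · rw [fold_apply, add_vec_apply_ne x e hi, Function.update_of_ne hi, fold_apply]

lemma sum_dir {d : ℕ} {M : Type*} [AddCommMonoid M] (F : Dir d → M) :
    ∑ e, F e = ∑ j, (F (j, 1) + F (j, -1)) := by
  rw [Fintype.sum_prod_type]
  refine Finset.sum_congr rfl fun j _ => ?_
  have : (Finset.univ : Finset ℤˣ) = {1, -1} := by decide
  rw [this, Finset.sum_pair (by decide)]

/-- The two folded neighbours of a point of the cube in a given coordinate. -/
lemma pair_sum_fold {d N : ℕ} (hN : 0 < N) {M : Type*} [AddCommMonoid M] (G : Lattice d → M)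
    (x : Lattice d) (j : Fin d) :
    G (fold N (x + Dir.vec (j, 1))) + G (fold N (x + Dir.vec (j, -1))) =
      G (Function.update (fold N x) j (min (fold N x j + 1) (N - 1))) +
      G (Function.update (fold N x) j (max (fold N x j - 1) 0)) := by
  rw [fold_add_vec, fold_add_vec]
  simp only [fold_apply, Units.val_one, Units.val_neg, ← sub_eq_add_neg]
  rcases foldInt_step hN (x j) with h | h
  · rw [h.1, h.2]
  · rw [h.1, h.2, add_comm]

/-- Balancedness of a single jump distribution. -/
def BalancedAt {d : ℕ} (p : Dir d → ℝ) : Prop := ∀ j, p (j, 1) = p (j, -1)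

lemma IsBalanced.balancedAt {d : ℕ} {ω : Env d} (h : IsBalanced ω) (z : Lattice d) :
    BalancedAt (ω z).1 := fun j => h z (j, 1)

lemma IsBalanced.periodized {d : ℕ} {ω : Env d} (h : IsBalanced ω) (N : ℕ) :
    IsBalanced (periodized ω N) := fun z e => h (fold N z) e

/-- Equal weights on `±e_j` make the order of the two folded neighbours irrelevant, so the folded
walk is Markov. `F` may depend on the direction because the set of unmoved coordinates is carried
along. -/
lemma sum_dir_fold {d N : ℕ} (hN : 0 < N) {p : Dir d → ℝ} (hp : BalancedAt p)
    (F : Fin d → Lattice d → ℝ) {x x' : Lattice d} (h : fold N x = fold N x') :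
    ∑ e : Dir d, p e * F e.1 (fold N (x + e.vec)) =
      ∑ e : Dir d, p e * F e.1 (fold N (x' + e.vec)) := by
  rw [sum_dir, sum_dir]
  refine Finset.sum_congr rfl fun j _ => ?_
  rw [← hp j, ← mul_add, ← mul_add, pair_sum_fold hN, pair_sum_fold hN, h]

lemma jump_nonneg {d : ℕ} (p : LocalEnv d) (e : Dir d) : 0 ≤ p.1 e := p.2.1 e

lemma sum_jump {d : ℕ} (p : LocalEnv d) : ∑ e, p.1 e = 1 := p.2.2

/-! ### The walk stopped when all coordinates have moved -/

/-- The expectation of `φ` after `n` steps of the walk in `η`, stopped once every coordinate has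
moved; the second argument is the set of coordinates that have not moved yet. -/
def stoppedExp {d : ℕ} (η : Env d) (φ : Lattice d → Finset (Fin d) → ℝ) :
    ℕ → Lattice d → Finset (Fin d) → ℝ
  | 0, x, S => φ x S
  | n + 1, x, S =>
    if S = ∅ then φ x S else ∑ e : Dir d, (η x).1 e * stoppedExp η φ n (x + e.vec) (S.erase e.1)

/-- The probability that coordinate `i` does not move in the first `n` steps. -/
def survival {d : ℕ} (η : Env d) (i : Fin d) : ℕ → Lattice d → ℝ
  | 0, _ => 1
  | n + 1, x => ∑ e : Dir d, if e.1 = i then 0 else (η x).1 e * survival η i n (x + e.vec)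

/-- The partial Green function of the walk killed when coordinate `i` moves. -/
def green {d : ℕ} (η : Env d) (i : Fin d) (n : ℕ) (x : Lattice d) : ℝ :=
  ∑ k ∈ Finset.range n, survival η i k x

section

variable {d : ℕ} (η : Env d)

lemma stoppedExp_empty (φ : Lattice d → Finset (Fin d) → ℝ) (n : ℕ) (x : Lattice d) :
    stoppedExp η φ n x ∅ = φ x ∅ := by
  cases n <;> simp [stoppedExp]

lemma stoppedExp_succ (φ : Lattice d → Finset (Fin d) → ℝ) (n : ℕ) (x : Lattice d)
    {S : Finset (Fin d)} (hS : S ≠ ∅) : stoppedExp η φ (n + 1) x S =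
      ∑ e : Dir d, (η x).1 e * stoppedExp η φ n (x + e.vec) (S.erase e.1) := by
  simp [stoppedExp, hS]

lemma stoppedExp_add (φ ψ : Lattice d → Finset (Fin d) → ℝ) (n : ℕ) (x : Lattice d)
    (S : Finset (Fin d)) : stoppedExp η (fun x S => φ x S + ψ x S) n x S =
      stoppedExp η φ n x S + stoppedExp η ψ n x S := by
  induction n generalizing x S with
  | zero => rfl
  | succ n ih =>
    by_cases hS : S = ∅
    · subst hS; simp [stoppedExp_empty]
    · simp only [stoppedExp_succ η _ n x hS, ih, mul_add, Finset.sum_add_distrib]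

lemma stoppedExp_const_mul (c : ℝ) (φ : Lattice d → Finset (Fin d) → ℝ) (n : ℕ) (x : Lattice d)
    (S : Finset (Fin d)) : stoppedExp η (fun x S => c * φ x S) n x S =
      c * stoppedExp η φ n x S := by
  induction n generalizing x S with
  | zero => rfl
  | succ n ih =>
    by_cases hS : S = ∅
    · subst hS; simp [stoppedExp_empty]
    · simp only [stoppedExp_succ η _ n x hS, ih, Finset.mul_sum]
      exact Finset.sum_congr rfl fun e _ => by ring

lemma stoppedExp_sub (φ ψ : Lattice d → Finset (Fin d) → ℝ) (n : ℕ) (x : Lattice d)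
    (S : Finset (Fin d)) : stoppedExp η (fun x S => φ x S - ψ x S) n x S =
      stoppedExp η φ n x S - stoppedExp η ψ n x S := by
  have h := stoppedExp_add η φ (fun x S => -1 * ψ x S) n x S
  rw [stoppedExp_const_mul] at h
  rw [sub_eq_add_neg, ← neg_one_mul (stoppedExp η ψ n x S), ← h]
  congr 1
  funext x S
  ring

lemma stoppedExp_const (c : ℝ) (n : ℕ) (x : Lattice d) (S : Finset (Fin d)) :
    stoppedExp η (fun _ _ => c) n x S = c := by
  induction n generalizing x S with
  | zero => rfl
  | succ n ih =>
    by_cases hS : S = ∅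
    · subst hS; simp [stoppedExp_empty]
    · simp only [stoppedExp_succ η _ n x hS, ih, ← Finset.sum_mul, sum_jump, one_mul]

lemma stoppedExp_sum {ι : Type*} (s : Finset ι) (φ : ι → Lattice d → Finset (Fin d) → ℝ) (n : ℕ)
    (x : Lattice d) (S : Finset (Fin d)) :
    stoppedExp η (fun x S => ∑ i ∈ s, φ i x S) n x S = ∑ i ∈ s, stoppedExp η (φ i) n x S := by
  classical
  induction s using Finset.induction_on with
  | empty => simp [stoppedExp_const]
  | insert a s ha ih =>
    simp only [Finset.sum_insert ha]
    rw [stoppedExp_add, ih]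

lemma stoppedExp_mono {φ ψ : Lattice d → Finset (Fin d) → ℝ} (h : ∀ x S, φ x S ≤ ψ x S) (n : ℕ)
    (x : Lattice d) (S : Finset (Fin d)) : stoppedExp η φ n x S ≤ stoppedExp η ψ n x S := by
  induction n generalizing x S with
  | zero => exact h x S
  | succ n ih =>
    by_cases hS : S = ∅
    · subst hS; simp only [stoppedExp_empty]; exact h x ∅
    · simp only [stoppedExp_succ η _ n x hS]
      exact Finset.sum_le_sum fun e _ => mul_le_mul_of_nonneg_left (ih _ _) (jump_nonneg _ _)

lemma stoppedExp_nonneg {φ : Lattice d → Finset (Fin d) → ℝ} (h : ∀ x S, 0 ≤ φ x S) (n : ℕ)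
    (x : Lattice d) (S : Finset (Fin d)) : 0 ≤ stoppedExp η φ n x S := by
  rw [← stoppedExp_const η 0 n x S]
  exact stoppedExp_mono η h n x S

variable {η}

lemma sum_jump_mul_of_pair {p : LocalEnv d} (hp : BalancedAt p.1) {F : Dir d → ℝ} {c : ℝ}
    (h : ∀ j, F (j, 1) + F (j, -1) = 2 * c) : ∑ e, p.1 e * F e = c := by
  have h1 : ∑ e, p.1 e * F e = ∑ e, p.1 e * c := by
    rw [sum_dir, sum_dir]
    refine Finset.sum_congr rfl fun j _ => ?_
    rw [← hp j, ← mul_add, h]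
    ring
  rw [h1, ← Finset.sum_mul, sum_jump, one_mul]

/-- Dynkin's formula: each step before stopping adds `a` in the mean, whichever coordinate is
chosen, so only the expected number of such steps enters. -/
lemma stoppedExp_quadratic (hη : IsBalanced η) {F : Lattice d → ℝ} {a : ℝ}
    (hF : ∀ x j, F (x + Dir.vec (j, 1)) + F (x + Dir.vec (j, -1)) = 2 * (F x + a)) (n : ℕ)
    (x : Lattice d) (S : Finset (Fin d)) : stoppedExp η (fun x _ => F x) n x S = F x +
      a * ∑ k ∈ Finset.range n, stoppedExp η (fun _ S => if S = ∅ then 0 else 1) k x S := by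
  induction n generalizing x S with
  | zero => simp [stoppedExp]
  | succ n ih =>
    by_cases hS : S = ∅
    · subst hS; simp [stoppedExp_empty]
    · rw [Finset.sum_range_succ']
      simp only [stoppedExp_succ η _ _ x hS, ih, mul_add, Finset.sum_add_distrib]
      rw [sum_jump_mul_of_pair (F := fun e => F (x + e.vec)) (hη.balancedAt x) (hF x)]
      simp only [Finset.mul_sum]
      rw [Finset.sum_comm]
      simp only [stoppedExp, if_neg hS, mul_left_comm a]
      ring

lemma stoppedExp_harmonic (hη : IsBalanced η) {F : Lattice d → ℝ}
    (hF : ∀ x j, F (x + Dir.vec (j, 1)) + F (x + Dir.vec (j, -1)) = 2 * F x) (n : ℕ)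
    (x : Lattice d) (S : Finset (Fin d)) : stoppedExp η (fun x _ => F x) n x S = F x := by
  rw [stoppedExp_quadratic (a := 0) hη (by simpa using hF), zero_mul, add_zero]

lemma abs_le_stoppedExp_abs (hη : IsBalanced η) {F : Lattice d → ℝ}
    (hF : ∀ x j, F (x + Dir.vec (j, 1)) + F (x + Dir.vec (j, -1)) = 2 * F x) (n : ℕ)
    (x : Lattice d) (S : Finset (Fin d)) : |F x| ≤ stoppedExp η (fun x _ => |F x|) n x S := by
  rw [abs_le']
  constructor
  · conv_lhs => rw [← stoppedExp_harmonic hη hF n x S]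
    exact stoppedExp_mono η (fun _ _ => le_abs_self _) n x S
  · rw [← stoppedExp_harmonic (F := fun x => - F x) hη (fun x j => by linarith [hF x j]) n x S]
    exact stoppedExp_mono η (fun _ _ => neg_le_abs _) n x S

/-- A linear functional moves at least by its coefficient once the coordinate has moved. -/
lemma le_stoppedExp_abs (hη : IsBalanced η) {F : Lattice d → ℝ} {r : Fin d → ℝ}
    (hF1 : ∀ x j, F (x + Dir.vec (j, 1)) = F x + r j)
    (hF2 : ∀ x j, F (x + Dir.vec (j, -1)) = F x - r j) (j : Fin d) (n : ℕ)
    (x : Lattice d) {S : Finset (Fin d)} (hj : j ∈ S) :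
    |r j| * stoppedExp η (fun _ S => if j ∈ S then 0 else 1) n x S ≤
      stoppedExp η (fun x _ => |F x|) n x S := by
  have hF : ∀ x j, F (x + Dir.vec (j, 1)) + F (x + Dir.vec (j, -1)) = 2 * F x := fun x j => by
    rw [hF1, hF2]; ring
  induction n generalizing x S with
  | zero => simp [stoppedExp, hj]
  | succ n ih =>
    have hS : S ≠ ∅ := Finset.ne_empty_of_mem hj
    simp only [stoppedExp_succ η _ n x hS, Finset.mul_sum]
    rw [sum_dir, sum_dir]
    refine Finset.sum_le_sum fun k _ => ?_
    have hp := hη.balancedAt x k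
    have hp0 := jump_nonneg (η x) (k, 1)
    rw [← hp]
    by_cases hk : k = j
    · subst hk
      have h1 : ∀ y T, stoppedExp η (fun _ S => if k ∈ S then (0 : ℝ) else 1) n y T ≤ 1 := by
        intro y T
        refine (stoppedExp_mono η (ψ := fun _ _ => 1) (fun _ S => ?_) n y T).trans_eq
          (stoppedExp_const η 1 n y T)
        split_ifs <;> norm_num
      have h2 := abs_le_stoppedExp_abs hη hF n (x + Dir.vec (k, 1)) (S.erase k)
      have h3 := abs_le_stoppedExp_abs hη hF n (x + Dir.vec (k, -1)) (S.erase k)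
      rw [hF1] at h2
      rw [hF2] at h3
      -- When the coordinate first moves, averaging over the sign gives at least `|r k|`, whatever
      -- `F x` is. Afterwards `|F|` is a submartingale, so the gain is kept.
      have h4 : 2 * |r k| ≤ |F x + r k| + |F x - r k| := by
        have := abs_sub (F x + r k) (F x - r k)
        rw [show F x + r k - (F x - r k) = 2 * r k by ring, abs_mul, abs_two] at this
        exact this
      have h5 := mul_le_mul_of_nonneg_left (h1 (x + Dir.vec (k, 1)) (S.erase k)) (abs_nonneg (r k))
      have h6 := mul_le_mul_of_nonneg_left (h1 (x + Dir.vec (k, -1)) (S.erase k)) (abs_nonneg (r k))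
      have := mul_le_mul_of_nonneg_left (show
        |r k| * stoppedExp η (fun _ S => if k ∈ S then 0 else 1) n (x + Dir.vec (k, 1)) (S.erase k)
        + |r k| * stoppedExp η (fun _ S => if k ∈ S then 0 else 1) n (x + Dir.vec (k, -1))
          (S.erase k) ≤ stoppedExp η (fun x _ => |F x|) n (x + Dir.vec (k, 1)) (S.erase k) +
          stoppedExp η (fun x _ => |F x|) n (x + Dir.vec (k, -1)) (S.erase k) by linarith) hp0
      linarith
    · have hj' : j ∈ S.erase k := Finset.mem_erase.2 ⟨Ne.symm hk, hj⟩
      have h1 := mul_le_mul_of_nonneg_left (ih (x + Dir.vec (k, 1)) hj') hp0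
      have h2 := mul_le_mul_of_nonneg_left (ih (x + Dir.vec (k, -1)) hj') hp0
      simp only
      linarith

/-! ### Waiting time of a single coordinate -/

variable (η)

lemma survival_nonneg (i : Fin d) (n : ℕ) (x : Lattice d) : 0 ≤ survival η i n x := by
  induction n generalizing x with
  | zero => simp [survival]
  | succ n ih =>
    refine Finset.sum_nonneg fun e _ => ?_
    split_ifs
    · exact le_rfl
    · exact mul_nonneg (jump_nonneg _ _) (ih _)

lemma survival_succ_le (i : Fin d) (n : ℕ) (x : Lattice d) :
    survival η i (n + 1) x ≤ survival η i n x := by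
  induction n generalizing x with
  | zero =>
    rw [survival, survival, ← sum_jump (η x)]
    refine Finset.sum_le_sum fun e _ => ?_
    split_ifs
    · exact jump_nonneg _ _
    · simp [survival]
  | succ n ih =>
    rw [survival, survival]
    refine Finset.sum_le_sum fun e _ => ?_
    split_ifs
    · exact le_rfl
    · exact mul_le_mul_of_nonneg_left (ih _) (jump_nonneg _ _)

lemma survival_antitone (i : Fin d) (x : Lattice d) : Antitone fun n => survival η i n x :=
  antitone_nat_of_succ_le fun n => survival_succ_le η i n x

lemma survival_le_green_div (i : Fin d) (n : ℕ) (x : Lattice d) :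
    survival η i n x ≤ green η i (n + 1) x / (n + 1) := by
  rw [le_div_iff₀ (by positivity)]
  have h := Finset.card_nsmul_le_sum (Finset.range (n + 1)) (fun k => survival η i k x)
    (survival η i n x) fun k hk => survival_antitone η i x (Finset.mem_range_succ_iff.1 hk)
  rw [Finset.card_range, nsmul_eq_mul] at h
  rw [green]
  push_cast at h
  linarith

lemma green_nonneg (i : Fin d) (n : ℕ) (x : Lattice d) : 0 ≤ green η i n x :=
  Finset.sum_nonneg fun _ _ => survival_nonneg η i _ x

lemma green_succ (i : Fin d) (n : ℕ) (x : Lattice d) : green η i (n + 1) x =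
    1 + ∑ e : Dir d, if e.1 = i then 0 else (η x).1 e * green η i n (x + e.vec) := by
  rw [green, Finset.sum_range_succ', add_comm]
  simp only [survival, green]
  rw [Finset.sum_comm]
  congr 1
  refine Finset.sum_congr rfl fun e _ => ?_
  split_ifs
  · simp
  · rw [Finset.mul_sum]

/-- Stopping when no coordinate is left does not interfere with the event that `i` is still waiting.
-/
lemma stoppedExp_mem (i : Fin d) (n : ℕ) (x : Lattice d) (S : Finset (Fin d)) :
    stoppedExp η (fun _ S => if i ∈ S then 1 else 0) n x S =
      if i ∈ S then survival η i n x else 0 := by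
  induction n generalizing x S with
  | zero => simp [stoppedExp, survival]
  | succ n ih =>
    by_cases hS : S = ∅
    · subst hS; simp [stoppedExp_empty]
    · rw [stoppedExp_succ η _ n x hS]
      simp only [ih, Finset.mem_erase]
      by_cases hi : i ∈ S
      · simp only [hi, and_true, if_true, survival]
        refine Finset.sum_congr rfl fun e _ => ?_
        by_cases h : e.1 = i
        · simp [h]
        · simp [h, Ne.symm h]
      · simp [hi]

/-- The probability that some coordinate has not moved after `n` steps. -/
def unfinished (n : ℕ) (x : Lattice d) : ℝ :=
  stoppedExp η (fun _ S => if S = ∅ then 0 else 1) n x Finset.univ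

lemma unfinished_le (n : ℕ) (x : Lattice d) :
    unfinished η n x ≤ ∑ i, survival η i n x := by
  have h : ∀ i, survival η i n x =
      stoppedExp η (fun _ S => if i ∈ S then 1 else 0) n x Finset.univ := fun i => by
    rw [stoppedExp_mem, if_pos (Finset.mem_univ i)]
  simp only [h]
  rw [← stoppedExp_sum]
  refine stoppedExp_mono η (fun x S => ?_) n x _
  split_ifs with hS
  · exact Finset.sum_nonneg fun i _ => by split_ifs <;> norm_num
  · obtain ⟨i, hi⟩ := Finset.nonempty_iff_ne_empty.2 hS
    refine le_trans ?_ (Finset.single_le_sum (f := fun i => if i ∈ S then (1 : ℝ) else 0)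
      (fun j _ => by positivity) (Finset.mem_univ i))
    simp [hi]

lemma unfinished_nonneg (n : ℕ) (x : Lattice d) : 0 ≤ unfinished η n x :=
  stoppedExp_nonneg η (fun _ S => by positivity) n x _

lemma sum_unfinished_le (n : ℕ) (x : Lattice d) :
    ∑ k ∈ Finset.range n, unfinished η k x ≤ ∑ i, green η i n x := by
  simp only [green]
  rw [Finset.sum_comm]
  exact Finset.sum_le_sum fun k _ => unfinished_le η k x

end

/-! ### Invariance under folding -/

section

variable {d N : ℕ} {ω : Env d}

lemma stoppedExp_fold (hN : 0 < N) (hω : IsBalanced ω) (ψ : Lattice d → Finset (Fin d) → ℝ)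
    (n : ℕ) {x x' : Lattice d} (h : fold N x = fold N x') (S : Finset (Fin d)) :
    stoppedExp (periodized ω N) (fun x S => ψ (fold N x) S) n x S =
      stoppedExp (periodized ω N) (fun x S => ψ (fold N x) S) n x' S := by
  induction n generalizing x x' S with
  | zero => simp [stoppedExp, h]
  | succ n ih =>
    by_cases hS : S = ∅
    · subst hS; simp [stoppedExp_empty, h]
    · simp only [stoppedExp_succ _ _ n _ hS]
      -- By induction the inner expectation is a function of the folded point, the form
      -- `sum_dir_fold` requires.
      have key : ∀ y : Lattice d, stoppedExp (periodized ω N) (fun x S => ψ (fold N x) S) n y =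
          stoppedExp (periodized ω N) (fun x S => ψ (fold N x) S) n (fold N y) :=
        fun y => funext fun T => ih (fold_fold hN y).symm T
      simp only [key (_ + _)]
      have := sum_dir_fold hN (hω.balancedAt (fold N x)) (fun j y =>
        stoppedExp (periodized ω N) (fun x S => ψ (fold N x) S) n y (S.erase j)) h
      rw [show periodized ω N x' = ω (fold N x) by rw [h]; rfl]
      exact this

lemma survival_fold (hN : 0 < N) (hω : IsBalanced ω) (i : Fin d) (n : ℕ) {x x' : Lattice d}
    (h : fold N x = fold N x') :
    survival (periodized ω N) i n x = survival (periodized ω N) i n x' := by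
  have h1 := stoppedExp_mem (periodized ω N) i n x Finset.univ
  have h2 := stoppedExp_mem (periodized ω N) i n x' Finset.univ
  rw [if_pos (Finset.mem_univ i)] at h1 h2
  rw [← h1, ← h2]
  exact stoppedExp_fold hN hω (fun _ S => if i ∈ S then 1 else 0) n h _

lemma green_fold (hN : 0 < N) (hω : IsBalanced ω) (i : Fin d) (n : ℕ) (x : Lattice d) :
    green (periodized ω N) i n x = green (periodized ω N) i n (fold N x) :=
  Finset.sum_congr rfl fun _ _ => survival_fold hN hω i _ (fold_fold hN x).symm

end

/-! ### The quenched law and the stopped walk -/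

section

variable {d : ℕ} (η : Env d) (z : Lattice d)

instance : IsProbabilityMeasure (quenchedLaw η z) := by
  unfold quenchedLaw
  infer_instance

/-- Extension of a finite path to a path indexed by `ℕ`. -/
def extendPath {d n : ℕ} (x : (i : Finset.Iic n) → (fun _ : ℕ => Lattice d) i) : ℕ → Lattice d :=
  fun k => if h : k ≤ n then x ⟨k, Finset.mem_Iic.2 h⟩ else 0

lemma extendPath_restrict {n k : ℕ} (hk : k ≤ n) (X : ℕ → Lattice d) :
    extendPath (Preorder.frestrictLe n X) k = X k := by
  simp [extendPath, hk]

/-- Finite lattice paths form a countable space, where every set is measurable. -/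
lemma measurableSet_of_agree {n : ℕ} {A : Set (ℕ → Lattice d)}
    (hA : ∀ X X' : ℕ → Lattice d, (∀ k ≤ n, X k = X' k) → (X ∈ A ↔ X' ∈ A)) :
    MeasurableSet A := by
  have : A = Preorder.frestrictLe (π := fun _ => Lattice d) n ⁻¹' {x | extendPath x ∈ A} := by
    ext X
    exact hA _ _ fun k hk => (extendPath_restrict hk X).symm
  rw [this]
  exact (Set.to_countable _).measurableSet.preimage (Preorder.measurable_frestrictLe n)

lemma lintegral_stepMeasure (x : Lattice d) (g : Lattice d → ℝ≥0∞) :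
    ∫⁻ y, g y ∂(stepMeasure η x) = ∑ e, ENNReal.ofReal ((η x).1 e) * g (x + e.vec) := by
  simp [stepMeasure]

/-- The Markov property at a deterministic time. -/
lemma lintegral_quenchedLaw_succ (n : ℕ) {G : (ℕ → Lattice d) → Lattice d → ℝ≥0∞}
    (hG : ∀ X X' : ℕ → Lattice d, (∀ k ≤ n, X k = X' k) → G X = G X') :
    ∫⁻ X, G X (X (n + 1)) ∂(quenchedLaw η z) =
      ∫⁻ X, ∑ e, ENNReal.ofReal ((η (X n)).1 e) * G X (X n + e.vec) ∂(quenchedLaw η z) := by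
  have hr : ∀ X : ℕ → Lattice d, G (extendPath (Preorder.frestrictLe n X)) = G X :=
    fun X => hG _ _ fun k hk => extendPath_restrict hk X
  have h := Kernel.partialTraj_compProd_eq_map_traj (X := fun _ : ℕ => Lattice d) (κ := historyKernel η) (Nat.zero_le n)
    (x₀ := fun _ => z)
  have hm : Measurable (fun p : ((i : Finset.Iic n) → (fun _ : ℕ => Lattice d) i) × Lattice d =>
      G (extendPath p.1) p.2) := measurable_of_countable _
  have h1 : ∫⁻ X, G X (X (n + 1)) ∂(quenchedLaw η z) =
      ∫⁻ p, G (extendPath p.1) p.2 ∂((quenchedLaw η z).map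
        (fun x ↦ (Preorder.frestrictLe n x, x (n + 1)))) := by
    rw [lintegral_map hm (by fun_prop)]
    simp only [hr]
  rw [h1, quenchedLaw, ← h, Measure.lintegral_compProd hm,
    ← Kernel.traj_map_frestrictLe_apply, lintegral_map (measurable_of_countable _) (by fun_prop)]
  refine lintegral_congr fun X => ?_
  simp only [hr]
  exact lintegral_stepMeasure η (X n) _

lemma lintegral_quenchedLaw_zero (g : Lattice d → ℝ≥0∞) :
    ∫⁻ X, g (X 0) ∂(quenchedLaw η z) = g z := by
  have h := Kernel.traj_map_frestrictLe_apply (X := fun _ : ℕ => Lattice d) (κ := historyKernel η) 0 0 (fun _ => z)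
  rw [Kernel.partialTraj_self, Kernel.id_apply] at h
  have hm : Measurable (fun x : (i : Finset.Iic 0) → (fun _ : ℕ => Lattice d) i =>
      g (x ⟨0, Finset.mem_Iic.2 le_rfl⟩)) := measurable_of_countable _
  have h1 : ∫⁻ X, g (X 0) ∂(quenchedLaw η z) =
      ∫⁻ x, g (x ⟨0, Finset.mem_Iic.2 le_rfl⟩) ∂((quenchedLaw η z).map
        (Preorder.frestrictLe (π := fun _ => Lattice d) 0)) := by
    rw [lintegral_map hm (by fun_prop)]
    rfl
  rw [h1, quenchedLaw, h, lintegral_dirac' _ hm]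

/-- The position of the walk stopped when all coordinates have moved, and the set of coordinates
that have not moved yet. -/
def pathState {d : ℕ} : ℕ → (ℕ → Lattice d) → Lattice d × Finset (Fin d)
  | 0, X => (X 0, Finset.univ)
  | n + 1, X => if (pathState n X).2 = ∅ then pathState n X else
      (X (n + 1), (pathState n X).2.filter fun i => X (n + 1) i = X n i)

lemma pathState_congr {n : ℕ} {X X' : ℕ → Lattice d} (h : ∀ k ≤ n, X k = X' k) :
    pathState n X = pathState n X' := by
  induction n with
  | zero => simp [pathState, h 0 le_rfl]
  | succ n ih =>
    have h1 := ih fun k hk => h k (hk.trans n.le_succ)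
    simp only [pathState, h1, h n n.le_succ, h (n + 1) le_rfl]

lemma pathState_fst {n : ℕ} {X : ℕ → Lattice d} (h : (pathState n X).2 ≠ ∅) :
    (pathState n X).1 = X n := by
  cases n with
  | zero => rfl
  | succ n =>
    rw [pathState] at h ⊢
    split_ifs with h1
    · rw [if_pos h1] at h
      exact absurd h1 h
    · rfl

lemma sum_ofReal_jump (p : LocalEnv d) : ∑ e, ENNReal.ofReal (p.1 e) = 1 := by
  rw [← ENNReal.ofReal_sum_of_nonneg fun e _ => jump_nonneg p e, sum_jump, ENNReal.ofReal_one]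

lemma filter_add_vec (S : Finset (Fin d)) (x : Lattice d) (e : Dir d) :
    (S.filter fun i => (x + e.vec) i = x i) = S.erase e.1 := by
  ext i
  rw [Finset.mem_filter, Finset.mem_erase, and_comm]
  refine and_congr_left fun _ => ⟨fun h hi => ?_, fun h => add_vec_apply_ne x e h⟩
  subst hi
  rw [add_vec_apply_self] at h
  have : (e.2 : ℤ) ≠ 0 := e.2.ne_zero
  lia

variable {z}

/-- The induction hands one step at a time from the recursion to the path measure, so the number `k`
of remaining steps has to stay free. At `k = 0` this is the law of the stopped state. -/
lemma lintegral_pathState {φ : Lattice d → Finset (Fin d) → ℝ} (hφ : ∀ x S, 0 ≤ φ x S)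
    (n k : ℕ) :
    ∫⁻ X, ENNReal.ofReal (stoppedExp η φ k (pathState n X).1 (pathState n X).2)
      ∂(quenchedLaw η z) = ENNReal.ofReal (stoppedExp η φ (n + k) z Finset.univ) := by
  induction n generalizing k with
  | zero =>
    rw [zero_add]
    exact lintegral_quenchedLaw_zero η z
      (fun x => ENNReal.ofReal (stoppedExp η φ k x Finset.univ))
  | succ n ih =>
    rw [show n + 1 + k = n + (k + 1) by lia, ← ih]
    have h := lintegral_quenchedLaw_succ η z n (G := fun X y =>
      if (pathState n X).2 = ∅ then
        ENNReal.ofReal (stoppedExp η φ k (pathState n X).1 (pathState n X).2) else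
      ENNReal.ofReal (stoppedExp η φ k y ((pathState n X).2.filter fun i => y i = X n i)))
      (fun X X' hX => by
        funext y
        simp only [pathState_congr hX, hX n le_rfl])
    convert h using 1
    · refine lintegral_congr fun X => ?_
      simp only [pathState]
      split_ifs <;> rfl
    · refine lintegral_congr fun X => ?_
      by_cases hS : (pathState n X).2 = ∅
      · simp only [hS, if_true, stoppedExp_empty]
        rw [← Finset.sum_mul, sum_ofReal_jump, one_mul]
      · simp only [hS, if_false]
        rw [stoppedExp_succ η _ _ _ hS, ENNReal.ofReal_sum_of_nonneg fun e _ =>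
          mul_nonneg (jump_nonneg _ _) (stoppedExp_nonneg η hφ _ _ _), pathState_fst hS]
        refine Finset.sum_congr rfl fun e _ => ?_
        rw [ENNReal.ofReal_mul (jump_nonneg _ _), filter_add_vec]

open Classical in
lemma quenchedLaw_pathState (p : Lattice d → Finset (Fin d) → Prop) (n : ℕ) :
    quenchedLaw η z {X | p (pathState n X).1 (pathState n X).2} =
      ENNReal.ofReal (stoppedExp η (fun x S => if p x S then 1 else 0) n z Finset.univ) := by
  have hA : MeasurableSet {X : ℕ → Lattice d | p (pathState n X).1 (pathState n X).2} :=
    measurableSet_of_agree (n := n) fun X X' h => by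
      simp only [Set.mem_ofPred_eq, pathState_congr h]
  have h := lintegral_pathState η (z := z) (φ := fun x S => if p x S then 1 else 0)
    (fun x S => by positivity) n 0
  rw [add_zero] at h
  rw [← h, ← lintegral_indicator_one hA]
  refine lintegral_congr fun X => ?_
  simp only [Set.indicator, Set.mem_ofPred_eq, stoppedExp, Pi.one_apply]
  split_ifs <;> simp

end

/-! ### The first rescaled time along a path -/

section

variable {d : ℕ} {X : ℕ → Lattice d}

/-- All coordinates have moved by time `n`. -/
def AllMoved {d : ℕ} (X : ℕ → Lattice d) (n : ℕ) : Prop :=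
  ∀ i, ∃ s : ℕ, 0 < s ∧ s ≤ n ∧ X s i ≠ X (s - 1) i

lemma AllMoved.mono {m n : ℕ} (h : AllMoved X m) (hmn : m ≤ n) : AllMoved X n := fun i => by
  obtain ⟨s, h1, h2, h3⟩ := h i
  exact ⟨s, h1, h2.trans hmn, h3⟩

open Classical in
lemma pathState_of_not_allMoved {n : ℕ} (h : ¬ AllMoved X n) : pathState n X =
    (X n, Finset.univ.filter fun i => ∀ s, 0 < s → s ≤ n → X s i = X (s - 1) i) := by
  induction n with
  | zero =>
    rw [pathState, Finset.filter_true_of_mem]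
    intro i _ s h1 h2
    lia
  | succ n ih =>
    have h1 : ¬ AllMoved X n := fun h' => h (h'.mono n.le_succ)
    have h2 := ih h1
    have hne : (pathState n X).2 ≠ ∅ := by
      rw [h2]
      unfold AllMoved at h1
      push Not at h1
      obtain ⟨i, hi⟩ := h1
      exact Finset.ne_empty_of_mem (Finset.mem_filter.2 ⟨Finset.mem_univ i, hi⟩)
    rw [pathState, if_neg hne, h2]
    refine Prod.ext rfl ?_
    ext i
    simp only [Finset.mem_filter, Finset.mem_univ, true_and]
    constructor
    · rintro ⟨h3, h4⟩ s hs hs'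
      rcases Nat.lt_or_ge n s with h5 | h5
      · obtain rfl : s = n + 1 := by lia
        exact h4
      · exact h3 s hs h5
    · intro h3
      exact ⟨fun s hs hs' => h3 s hs (hs'.trans n.le_succ), h3 (n + 1) n.succ_pos le_rfl⟩

open Classical in
lemma pathState_of_allMoved {t n : ℕ} (ht : AllMoved X t) (hlt : ∀ s < t, ¬ AllMoved X s)
    (ht0 : 0 < t) (hn : t ≤ n) : pathState n X = (X t, ∅) := by
  induction n, hn using Nat.le_induction with
  | base =>
    obtain ⟨m, rfl⟩ : ∃ m, t = m + 1 := ⟨t - 1, by lia⟩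
    have h1 := hlt m m.lt_succ_self
    have h2 := pathState_of_not_allMoved h1
    have hne : (pathState m X).2 ≠ ∅ := by
      rw [h2]
      unfold AllMoved at h1
      push Not at h1
      obtain ⟨i, hi⟩ := h1
      exact Finset.ne_empty_of_mem (Finset.mem_filter.2 ⟨Finset.mem_univ i, hi⟩)
    rw [pathState, if_neg hne, h2]
    refine Prod.ext rfl ?_
    refine Finset.filter_eq_empty_iff.2 fun i hi h3 => ?_
    simp only [Finset.mem_filter, Finset.mem_univ, true_and] at hi
    obtain ⟨s, h4, h5, h6⟩ := ht i
    rcases Nat.lt_or_ge m s with h7 | h7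
    · obtain rfl : s = m + 1 := by lia
      exact h6 h3
    · exact h6 (hi s h4 h7)
  | succ n hn ih => rw [pathState, ih, if_pos rfl]

lemma rescaledTime_one (X : ℕ → Lattice d) :
    rescaledTime X 1 = ⨅ (t : ℕ) (_ : 0 < t ∧ AllMoved X t), (t : ℕ∞) := by
  simp only [rescaledTime, Nat.cast_pos, AllMoved]

lemma rescaledTime_one_of_allMoved {t : ℕ} (ht : AllMoved X t) (hlt : ∀ s < t, ¬ AllMoved X s)
    (ht0 : 0 < t) : rescaledTime X 1 = t := by
  rw [rescaledTime_one]
  refine le_antisymm (iInf₂_le t ⟨ht0, ht⟩) (le_iInf₂ fun s hs => ?_)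
  exact_mod_cast not_lt.1 fun h => hlt s h hs.2

lemma not_allMoved_zero [Nonempty (Fin d)] : ¬ AllMoved X 0 := fun h => by
  obtain ⟨s, h1, h2, -⟩ := h (Classical.arbitrary _)
  lia

open Classical in
-- The stopped state freezes at `T_1` and then records `Y_1`. A coordinate must exist: otherwise the
-- state would already be final at time `0`, whereas `T_1` is positive.
lemma rescaledWalk_one_iff [Nonempty (Fin d)] (p : Lattice d → Prop) :
    (rescaledTime X 1 < ⊤ ∧ p (rescaledWalk X 1)) ↔
      ∃ n, p (pathState n X).1 ∧ (pathState n X).2 = ∅ := by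
  by_cases h : ∃ t, AllMoved X t
  · have ht := Nat.find_spec h
    have hlt : ∀ s < Nat.find h, ¬ AllMoved X s := fun s hs => Nat.find_min h hs
    have ht0 : 0 < Nat.find h := Nat.pos_of_ne_zero fun h0 => not_allMoved_zero (h0 ▸ ht)
    have hT := rescaledTime_one_of_allMoved ht hlt ht0
    rw [rescaledWalk, hT, ENat.toNat_natCast]
    constructor
    · rintro ⟨-, h1⟩
      refine ⟨Nat.find h, ?_⟩
      rw [pathState_of_allMoved ht hlt ht0 le_rfl]
      exact ⟨h1, rfl⟩
    · rintro ⟨n, h1, h2⟩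
      refine ⟨ENat.natCast_lt_top _, ?_⟩
      rcases Nat.lt_or_ge n (Nat.find h) with h3 | h3
      · have h4 := hlt n h3
        rw [pathState_of_not_allMoved h4] at h2
        unfold AllMoved at h4
        push Not at h4
        obtain ⟨i, hi⟩ := h4
        exact absurd h2 (Finset.ne_empty_of_mem (Finset.mem_filter.2 ⟨Finset.mem_univ i, hi⟩))
      · rwa [pathState_of_allMoved ht hlt ht0 h3] at h1
  · push Not at h
    constructor
    · rintro ⟨h1, -⟩
      rw [rescaledTime_one] at h1
      simp [h] at h1
    · rintro ⟨n, -, h2⟩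
      have h4 := h n
      rw [pathState_of_not_allMoved h4] at h2
      unfold AllMoved at h4
      push Not at h4
      obtain ⟨i, hi⟩ := h4
      exact absurd h2 (Finset.ne_empty_of_mem (Finset.mem_filter.2 ⟨Finset.mem_univ i, hi⟩))

lemma rescaledTime_lt_top (h : ∀ (t : ℕ) (i : Fin d), ∃ s, t < s ∧ X s i ≠ X (s - 1) i) (k : ℕ) :
    rescaledTime X k < ⊤ := by
  induction k with
  | zero => simp [rescaledTime]
  | succ k ih =>
    obtain ⟨t, ht⟩ := ENat.ne_top_iff_exists.1 ih.ne
    choose s hs using h t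
    rw [rescaledTime, ← ht]
    refine (iInf₂_le (t + 1 + ∑ i, s i) ⟨?_, fun i => ⟨s i, ?_, ?_, (hs i).2⟩⟩).trans_lt
      (ENat.natCast_lt_top _)
    · exact_mod_cast (by lia : t < t + 1 + ∑ i, s i)
    · exact_mod_cast (hs i).1
    · have := Finset.single_le_sum (f := s) (fun _ _ => Nat.zero_le _) (Finset.mem_univ i)
      lia

end

/-! ### Finiteness of the rescaled times -/

section

variable {d : ℕ} (η : Env d) (z : Lattice d)

/-- Coordinate `i` does not move in the time interval `(t, t + n]`. -/
def NotMoved {d : ℕ} (i : Fin d) (t n : ℕ) (X : ℕ → Lattice d) : Prop :=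
  ∀ s, t < s → s ≤ t + n → X s i = X (s - 1) i

open Classical in
-- The Markov property at time `t`, peeled off one step at a time; this gives the probability that
-- `i` rests during `(t, t + n]` when `k = 0`.
lemma lintegral_notMoved (i : Fin d) (t n k : ℕ) :
    ∫⁻ X, (if NotMoved i t n X then ENNReal.ofReal (survival η i k (X (t + n))) else 0)
      ∂(quenchedLaw η z) =
    ∫⁻ X, ENNReal.ofReal (survival η i (n + k) (X t)) ∂(quenchedLaw η z) := by
  induction n generalizing k with
  | zero =>
    refine lintegral_congr fun X => ?_
    rw [if_pos (by intro s h1 h2; lia), zero_add, add_zero]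
  | succ n ih =>
    rw [show n + 1 + k = n + (k + 1) by lia, ← ih]
    have h := lintegral_quenchedLaw_succ η z (t + n) (G := fun X y =>
      if NotMoved i t n X ∧ y i = X (t + n) i then ENNReal.ofReal (survival η i k y) else 0)
      (fun X X' hX => by
        have h1 : NotMoved i t n X ↔ NotMoved i t n X' := by
          refine forall_congr' fun s => forall₂_congr fun h1 h2 => ?_
          rw [hX s h2, hX (s - 1) (by lia)]
        funext y
        rw [h1, hX (t + n) le_rfl])
    convert h using 1
    · refine lintegral_congr fun X => ?_
      refine if_congr ⟨fun h => ⟨fun s h1 h2 => h s h1 (by lia), ?_⟩, fun h s h1 h2 => ?_⟩ rfl rfl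
      · exact h (t + n + 1) (by lia) (by lia)
      · rcases Nat.lt_or_ge (t + n) s with h3 | h3
        · obtain rfl : s = t + n + 1 := by lia
          exact h.2
        · exact h.1 s h1 h3
    · refine lintegral_congr fun X => ?_
      by_cases hM : NotMoved i t n X
      · simp only [hM, true_and, if_true]
        rw [survival, ENNReal.ofReal_sum_of_nonneg]
        · refine Finset.sum_congr rfl fun e _ => ?_
          by_cases he : e.1 = i
          · subst he
            rw [if_pos rfl, add_vec_apply_self, if_neg, ENNReal.ofReal_zero, mul_zero]
            have : (e.2 : ℤ) ≠ 0 := e.2.ne_zero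
            lia
          · rw [if_neg he, add_vec_apply_ne _ _ (Ne.symm he), if_pos rfl,
              ENNReal.ofReal_mul (jump_nonneg _ _)]
        · intro e _
          split_ifs
          · exact le_rfl
          · exact mul_nonneg (jump_nonneg _ _) (survival_nonneg η i k _)
      · simp [hM]

lemma ae_rescaledTime_lt_top
    (h : ∀ (i : Fin d) (ε : ℝ), 0 < ε → ∃ n, ∀ x, survival η i n x ≤ ε) :
    ∀ᵐ X ∂(quenchedLaw η z), ∀ k, rescaledTime X k < ⊤ := by
  classical
  -- The survival bound is uniform in the starting point, hence applies at the random position `X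
  -- t`.
  have key : ∀ (t : ℕ) (i : Fin d), ∀ᵐ X ∂(quenchedLaw η z), ∃ s, t < s ∧ X s i ≠ X (s - 1) i := by
    intro t i
    rw [ae_iff]
    refine le_antisymm (ENNReal.le_of_forall_pos_le_add fun ε hε _ => ?_) zero_le
    obtain ⟨n, hn⟩ := h i ε (by exact_mod_cast hε)
    have hA : MeasurableSet {X : ℕ → Lattice d | NotMoved i t n X} :=
      measurableSet_of_agree (n := t + n) fun X X' hX => by
        refine forall_congr' fun s => forall₂_congr fun h1 h2 => ?_
        rw [hX s h2, hX (s - 1) (by lia)]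
    have h1 := lintegral_notMoved η z i t n 0
    calc quenchedLaw η z {X | ¬ ∃ s, t < s ∧ X s i ≠ X (s - 1) i}
        ≤ quenchedLaw η z {X | NotMoved i t n X} := by
          refine measure_mono fun X hX => ?_
          simp only [Set.mem_ofPred_eq, not_exists, not_and, not_not] at hX
          exact fun s hs _ => hX s hs
      _ = ∫⁻ X, (if NotMoved i t n X then ENNReal.ofReal (survival η i 0 (X (t + n))) else 0)
            ∂(quenchedLaw η z) := by
          rw [← lintegral_indicator_one hA]
          refine lintegral_congr fun X => ?_
          simp [Set.indicator, survival]
      _ ≤ ∫⁻ X, ENNReal.ofReal ε ∂(quenchedLaw η z) := by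
          rw [h1]
          exact lintegral_mono fun X => ENNReal.ofReal_le_ofReal (hn _)
      _ = 0 + ε := by simp
  have h2 : ∀ᵐ X ∂(quenchedLaw η z), ∀ (t : ℕ) (i : Fin d), ∃ s, t < s ∧ X s i ≠ X (s - 1) i :=
    ae_all_iff.2 fun t => ae_all_iff.2 fun i => key t i
  filter_upwards [h2] with X hX k
  exact rescaledTime_lt_top hX k

open Classical in
/-- The transition probabilities of the folded rescaled walk as limits. -/
lemma tendsto_stoppedExp_foldedTransition [Nonempty (Fin d)] (ω : Env d) (N : ℕ)
    (x y : Lattice d) :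
    Tendsto (fun n => stoppedExp (periodized ω N)
      (fun x S => if fold N x = y ∧ S = ∅ then 1 else 0) n x Finset.univ) atTop
      (nhds (foldedTransition ω N x y).toReal) := by
  set A : ℕ → Set (ℕ → Lattice d) := fun n =>
    {X | fold N (pathState n X).1 = y ∧ (pathState n X).2 = ∅} with hA
  -- Stopped states are frozen, so the events increase and continuity from below applies.
  have hmono : Monotone A := by
    refine monotone_nat_of_le_succ fun n X hX => ?_
    simp only [hA, Set.mem_ofPred_eq] at hX ⊢
    rw [pathState, if_pos hX.2]
    exact hX
  have h1 : {X : ℕ → Lattice d | rescaledTime X 1 < ⊤ ∧ fold N (rescaledWalk X 1) = y} =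
      ⋃ n, A n := by
    ext X
    simp only [hA, Set.mem_ofPred_eq, Set.mem_iUnion]
    exact rescaledWalk_one_iff (fun x => fold N x = y)
  have h2 := tendsto_measure_iUnion_atTop (μ := quenchedLaw (periodized ω N) x) hmono
  rw [← h1] at h2
  have h3 := (ENNReal.tendsto_toReal (measure_ne_top _ _)).comp h2
  refine h3.congr fun n => ?_
  simp only [Function.comp_apply, hA]
  rw [quenchedLaw_pathState (periodized ω N) (fun x S => fold N x = y ∧ S = ∅) n]
  convert ENNReal.toReal_ofReal (stoppedExp_nonneg _ (fun x S => ?_) n x _)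
  positivity

end

/-! ### Comparison of the Green function with exit probabilities from boxes -/

/-- The folded point is at distance at most `r` from `c`. -/
def Near {d : ℕ} (N : ℕ) (c : Lattice d) (r : ℕ) (x : Lattice d) : Prop :=
  ∀ j, |fold N x j - c j| ≤ (r : ℤ)

instance {d : ℕ} (N : ℕ) (c : Lattice d) (r : ℕ) (x : Lattice d) : Decidable (Near N c r x) :=
  inferInstanceAs (Decidable (∀ j, |fold N x j - c j| ≤ (r : ℤ)))

/-- The probability that the folded walk leaves the box of radius `r` around `c` within `n` steps
and before coordinate `i` moves. -/
def reach {d : ℕ} (ω : Env d) (N : ℕ) (i : Fin d) (c : Lattice d) (r : ℕ) :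
    ℕ → Lattice d → ℝ
  | 0, x => if Near N c r x then 0 else 1
  | n + 1, x => if Near N c r x then
      ∑ e : Dir d, if e.1 = i then 0 else (ω (fold N x)).1 e * reach ω N i c r n (x + e.vec)
      else 1

section

variable {d N : ℕ} {ω : Env d} {i : Fin d} {c : Lattice d}

lemma Near.mono {r r' : ℕ} {x : Lattice d} (h : Near N c r x) (hr : r ≤ r') : Near N c r' x :=
  fun j => (h j).trans (by exact_mod_cast hr)

lemma near_self (hc : c ∈ cube d N) (r : ℕ) : Near N c r c := fun j => by
  rw [fold_of_mem hc, sub_self, abs_zero]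
  lia

lemma Near.add_vec (hN : 0 < N) {r : ℕ} {x : Lattice d} (h : Near N c r x) (e : Dir d) :
    Near N c (r + 1) (x + e.vec) := fun j => by
  have hj := h j
  rw [abs_le] at hj ⊢
  by_cases he : j = e.1
  · subst he
    have h0 := foldInt_nonneg hN (x e.1)
    have h1 := foldInt_lt hN (x e.1)
    rw [fold_apply] at hj ⊢
    rw [add_vec_apply_self]
    rcases Int.units_eq_one_or e.2 with h2 | h2 <;> rw [h2] <;>
      rcases foldInt_step hN (x e.1) with h3 | h3 <;>
      simp only [Units.val_one, Units.val_neg, ← sub_eq_add_neg, h3.1, h3.2] <;> lia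
  · rw [fold_apply, add_vec_apply_ne _ _ he, ← fold_apply]
    lia

lemma reach_of_not_near {r : ℕ} {x : Lattice d} (h : ¬ Near N c r x) (n : ℕ) :
    reach ω N i c r n x = 1 := by
  cases n <;> simp [reach, h]

lemma reach_succ {r : ℕ} {x : Lattice d} (h : Near N c r x) (n : ℕ) :
    reach ω N i c r (n + 1) x = ∑ e : Dir d, if e.1 = i then 0 else
      (ω (fold N x)).1 e * reach ω N i c r n (x + e.vec) := by
  simp [reach, h]

lemma reach_nonneg (r n : ℕ) (x : Lattice d) : 0 ≤ reach ω N i c r n x := by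
  induction n generalizing x with
  | zero => rw [reach]; positivity
  | succ n ih =>
    by_cases h : Near N c r x
    · rw [reach_succ h]
      refine Finset.sum_nonneg fun e _ => ?_
      split_ifs
      · exact le_rfl
      · exact mul_nonneg (jump_nonneg _ _) (ih _)
    · rw [reach_of_not_near h]
      exact zero_le_one

lemma reach_le_one (r n : ℕ) (x : Lattice d) : reach ω N i c r n x ≤ 1 := by
  induction n generalizing x with
  | zero => rw [reach]; split_ifs <;> norm_num
  | succ n ih =>
    by_cases h : Near N c r x
    · rw [reach_succ h, ← sum_jump (ω (fold N x))]
      refine Finset.sum_le_sum fun e _ => ?_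
      split_ifs
      · exact jump_nonneg _ _
      · exact mul_le_of_le_one_right (jump_nonneg _ _) (ih _)
    · rw [reach_of_not_near h]

lemma reach_le_succ (r n : ℕ) (x : Lattice d) :
    reach ω N i c r n x ≤ reach ω N i c r (n + 1) x := by
  induction n generalizing x with
  | zero =>
    by_cases h : Near N c r x
    · rw [reach, if_pos h]
      exact reach_nonneg r 1 x
    · rw [reach_of_not_near h, reach_of_not_near h]
  | succ n ih =>
    by_cases h : Near N c r x
    · rw [reach_succ h, reach_succ h]
      refine Finset.sum_le_sum fun e _ => ?_
      split_ifs
      · exact le_rfl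
      · exact mul_le_mul_of_nonneg_left (ih _) (jump_nonneg _ _)
    · rw [reach_of_not_near h, reach_of_not_near h]

/-- The centre of the paraboloid used on the box of radius `r` around `c`. -/
noncomputable def paraboloidCenter (N : ℕ) (c : ℤ) (r : ℕ) : ℝ :=
  if c ≤ r then -1 / 2 else if (N : ℤ) - 1 - r ≤ c then N - 1 / 2 else c

/-- A superharmonic function on the box of radius `r` around `c`. -/
noncomputable def paraboloid {d : ℕ} (N : ℕ) (c : Lattice d) (r : ℕ) (y : Lattice d) : ℝ :=
  ∑ j, ((2 * r + 4 : ℝ) ^ 2 - ((y j : ℝ) - paraboloidCenter N (c j) r) ^ 2)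

/-- The upper bound for `paraboloid`. -/
def paraboloidBound (d r : ℕ) : ℝ := d * (2 * r + 4 : ℝ) ^ 2

lemma paraboloidBound_nonneg (d r : ℕ) : 0 ≤ paraboloidBound d r := by
  unfold paraboloidBound; positivity

lemma paraboloid_le (r : ℕ) (y : Lattice d) : paraboloid N c r y ≤ paraboloidBound d r := by
  have h : ∀ j ∈ (Finset.univ : Finset (Fin d)),
      (2 * r + 4 : ℝ) ^ 2 - ((y j : ℝ) - paraboloidCenter N (c j) r) ^ 2 ≤ (2 * r + 4 : ℝ) ^ 2 :=
    fun j _ => sub_le_self _ (sq_nonneg _)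
  refine (Finset.sum_le_sum h).trans ?_
  simp [paraboloidBound]

lemma abs_sub_paraboloidCenter_le {c y : ℤ} {r : ℕ}
    (hy : 0 ≤ y ∧ y < N) (h : |y - c| ≤ (r : ℤ) + 1) :
    |(y : ℝ) - paraboloidCenter N c r| ≤ 2 * r + 4 := by
  rw [abs_le] at h ⊢
  have h1 : (y : ℝ) - c ≤ r + 1 := by exact_mod_cast h.2
  have h2 : (-(r + 1) : ℝ) ≤ y - c := by exact_mod_cast h.1
  have h3 : (0 : ℝ) ≤ y := by exact_mod_cast hy.1
  have h4 : (y : ℝ) < N := by exact_mod_cast hy.2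
  unfold paraboloidCenter
  split_ifs with h5 h6
  · have h7 : (c : ℝ) ≤ r := by exact_mod_cast h5
    constructor <;> linarith
  · have h7 : (N : ℝ) - 1 - r ≤ c := by exact_mod_cast h6
    constructor <;> linarith
  · have : (0 : ℝ) ≤ r := by positivity
    constructor <;> linarith

lemma paraboloid_nonneg (hN : 0 < N) {r : ℕ} {x : Lattice d} (h : Near N c (r + 1) x) : 0 ≤ paraboloid N c r (fold N x) := by
  refine Finset.sum_nonneg fun j _ => ?_
  have h1 := abs_sub_paraboloidCenter_le (mem_cube.1 (fold_mem_cube hN x) j)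
    (by exact_mod_cast h j)
  rw [sub_nonneg]
  exact sq_le_sq' (abs_le.1 h1).1 (abs_le.1 h1).2

/-- In the interior this is the second difference of a square. At a wall one folded step stays put,
and the identity survives because the centre then lies on the reflection axis `-1/2` or `N - 1/2`.
The condition on `r` prevents the box from meeting both walls. -/
lemma paraboloidCenter_step {c y : ℤ} {r : ℕ} (hr : 2 * r + 1 < N)
    (hy : 0 ≤ y ∧ y < N) (h : |y - c| ≤ (r : ℤ)) :
    (((min (y + 1) (N - 1) : ℤ) : ℝ) - paraboloidCenter N c r) ^ 2 +
      (((max (y - 1) 0 : ℤ) : ℝ) - paraboloidCenter N c r) ^ 2 =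
      2 * ((y : ℝ) - paraboloidCenter N c r) ^ 2 + 2 := by
  rw [abs_le] at h
  unfold paraboloidCenter
  rcases eq_or_lt_of_le hy.1 with h1 | h1
  · rw [if_pos (by lia), min_eq_left (by lia), max_eq_right (by lia), ← h1]
    norm_num
  · rw [max_eq_left (by lia)]
    rcases eq_or_lt_of_le (show y ≤ N - 1 by lia) with h2 | h2
    · rw [min_eq_right (by lia), if_neg (by lia), if_pos (by lia), h2]
      push_cast
      ring
    · rw [min_eq_left (by lia)]
      push_cast
      ring

lemma paraboloid_update (r : ℕ) (y : Lattice d) (j : Fin d) (a : ℤ) :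
    paraboloid N c r (Function.update y j a) = paraboloid N c r y +
      ((y j : ℝ) - paraboloidCenter N (c j) r) ^ 2 - (a - paraboloidCenter N (c j) r) ^ 2 := by
  unfold paraboloid
  rw [← Finset.add_sum_erase _ _ (Finset.mem_univ j),
    ← Finset.add_sum_erase (Finset.univ : Finset (Fin d)) (fun k => (2 * r + 4 : ℝ) ^ 2 -
      ((y k : ℝ) - paraboloidCenter N (c k) r) ^ 2) (Finset.mem_univ j)]
  rw [Finset.sum_congr rfl (fun k hk => by
    rw [Function.update_of_ne (Finset.ne_of_mem_erase hk)]), Function.update_self]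
  ring

lemma sum_jump_paraboloid (hN : 0 < N) (hω : IsBalanced ω) {r : ℕ} (hr : 2 * r + 1 < N)
    {x : Lattice d} (h : Near N c r x) :
    ∑ e : Dir d, (ω (fold N x)).1 e * paraboloid N c r (fold N (x + e.vec)) =
      paraboloid N c r (fold N x) - 1 := by
  refine sum_jump_mul_of_pair (F := fun e => paraboloid N c r (fold N (x + e.vec)))
    (hω.balancedAt _) fun j => ?_
  rw [pair_sum_fold hN, paraboloid_update, paraboloid_update]
  have := paraboloidCenter_step hr (mem_cube.1 (fold_mem_cube hN x) j) (h j)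
  linarith

/-- The paraboloid falls by one per step in the mean, which pays for the time spent in the current
box. On leaving the box of radius `k` the comparison restarts with the next paraboloid, at a cost at
most its maximum, charged to `reach`. Beyond `R` only the a priori bound `s` is left. -/
lemma green_le_of_near (hN : 0 < N) (hω : IsBalanced ω) {R : ℕ} (hR : 2 * R + 1 < N) {s : ℝ} (n : ℕ)
    (hs : ∀ m ≤ n, ∀ x, green (periodized ω N) i m x ≤ s) {r : ℕ} (hr : r ≤ R) {x : Lattice d}
    (hx : Near N c r x) :
    green (periodized ω N) i n x ≤ paraboloid N c r (fold N x) +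
      ∑ k ∈ Finset.Ico r R, paraboloidBound d (k + 1) * reach ω N i c k n x +
      s * reach ω N i c R n x := by
  have hs0 : 0 ≤ s := by simpa [green] using hs 0 (Nat.zero_le n) x
  induction n generalizing r x with
  | zero =>
    have h1 := paraboloid_nonneg hN (hx.mono r.le_succ)
    have h2 : 0 ≤ ∑ k ∈ Finset.Ico r R, paraboloidBound d (k + 1) * reach ω N i c k 0 x :=
      Finset.sum_nonneg fun k _ => mul_nonneg (paraboloidBound_nonneg _ _) (reach_nonneg _ _ _)
    have h3 := mul_nonneg hs0 (reach_nonneg (ω := ω) (i := i) (N := N) (c := c) R 0 x)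
    rw [green, Finset.sum_range_zero]
    linarith
  | succ n ih =>
    have ih' := fun (r : ℕ) (hr : r ≤ R) (x : Lattice d) (hx : Near N c r x) =>
      ih (fun m hm => hs m (hm.trans n.le_succ)) hr hx
    have key : ∀ y, Near N c (r + 1) y → green (periodized ω N) i n y ≤
        paraboloid N c r (fold N y) +
        ∑ k ∈ Finset.Ico r R, paraboloidBound d (k + 1) * reach ω N i c k n y +
        s * reach ω N i c R n y := by
      intro y hy
      by_cases h1 : Near N c r y
      · exact ih' r hr y h1
      · have h0 := paraboloid_nonneg hN hy
        rcases Nat.lt_or_ge r R with h2 | h2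
        · have h3 := ih' (r + 1) h2 y hy
          rw [Finset.sum_eq_sum_Ico_succ_bot h2, reach_of_not_near h1]
          have h4 := paraboloid_le (N := N) (c := c) (r + 1) (fold N y)
          linarith
        · obtain rfl : r = R := by lia
          rw [reach_of_not_near h1, Finset.Ico_self, Finset.sum_empty]
          linarith [hs n n.le_succ y]
    have hstep : ∀ k, r ≤ k → ∑ e : Dir d, (if e.1 = i then 0 else (ω (fold N x)).1 e *
        reach ω N i c k n (x + e.vec)) = reach ω N i c k (n + 1) x :=
      fun k hk => (reach_succ (hx.mono hk) n).symm
    have hsum : ∑ k ∈ Finset.Ico r R, paraboloidBound d (k + 1) * reach ω N i c k (n + 1) x =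
        ∑ k ∈ Finset.Ico r R, paraboloidBound d (k + 1) * ∑ e : Dir d, (if e.1 = i then 0 else
          (ω (fold N x)).1 e * reach ω N i c k n (x + e.vec)) :=
      Finset.sum_congr rfl fun k hk => by rw [hstep k (Finset.mem_Ico.1 hk).1]
    rw [green_succ, ← hstep R hr, hsum]
    have hq := sum_jump_paraboloid hN hω (by lia : 2 * r + 1 < N) hx
    have hle : ∑ e : Dir d, (if e.1 = i then 0 else
        (periodized ω N x).1 e * green (periodized ω N) i n (x + e.vec)) ≤
        ∑ e : Dir d, ((ω (fold N x)).1 e * paraboloid N c r (fold N (x + e.vec)) +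
        ∑ k ∈ Finset.Ico r R, paraboloidBound d (k + 1) * (if e.1 = i then 0 else
          (ω (fold N x)).1 e * reach ω N i c k n (x + e.vec)) +
        s * (if e.1 = i then 0 else (ω (fold N x)).1 e * reach ω N i c R n (x + e.vec))) := by
      refine Finset.sum_le_sum fun e _ => ?_
      have hp := jump_nonneg (ω (fold N x)) e
      by_cases he : e.1 = i
      -- A move of coordinate `i` ends the count, and the paraboloid is still nonnegative one step
      -- outside the box.
      · simp only [he, if_true, mul_zero, Finset.sum_const_zero, add_zero]
        exact mul_nonneg hp (paraboloid_nonneg hN (hx.add_vec hN e))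
      · simp only [he, if_false]
        refine (mul_le_mul_of_nonneg_left (key _ (hx.add_vec hN e)) hp).trans_eq ?_
        rw [mul_add, mul_add, Finset.mul_sum]
        congr 1
        · congr 1
          exact Finset.sum_congr rfl fun k _ => by ring
        · ring
    rw [Finset.sum_add_distrib, Finset.sum_add_distrib, hq, Finset.sum_comm] at hle
    simp only [← Finset.mul_sum] at hle
    linarith

lemma green_mono (η : Env d) (i : Fin d) {m n : ℕ} (h : m ≤ n) (x : Lattice d) :
    green η i m x ≤ green η i n x :=
  Finset.sum_le_sum_of_subset_of_nonneg (Finset.range_mono h)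
    fun _ _ _ => survival_nonneg η i _ x

lemma green_le (η : Env d) (i : Fin d) (n : ℕ) (x : Lattice d) : green η i n x ≤ n := by
  have h : ∀ k ∈ Finset.range n, survival η i k x ≤ 1 := fun k _ =>
    survival_antitone η i x (Nat.zero_le k)
  simpa [green] using Finset.sum_le_sum h

lemma green_center_le (hN : 0 < N) (hω : IsBalanced ω) (hc : c ∈ cube d N) {R : ℕ}
    (hR : 2 * R + 1 < N) {s : ℝ} (n : ℕ)
    (hs : ∀ x, green (periodized ω N) i n x ≤ s) :
    green (periodized ω N) i n c ≤ paraboloidBound d 0 +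
      ∑ k ∈ Finset.range R, paraboloidBound d (k + 1) * reach ω N i c k n c +
      s * reach ω N i c R n c := by
  have h := green_le_of_near hN hω hR n (fun m hm x => (green_mono _ _ hm x).trans (hs x))
    (Nat.zero_le R) (near_self hc 0) (i := i)
  rw [← Finset.range_eq_Ico] at h
  have := paraboloid_le (N := N) (c := c) 0 (fold N c)
  linarith

/-- A uniform bound for the Green function when exit probabilities of large boxes are small. -/
lemma green_le_of_reach_le (hN : 0 < N) (hω : IsBalanced ω) {R : ℕ} (hR : 2 * R + 1 < N)
    (hreach : ∀ c ∈ cube d N, ∀ n, reach ω N i c R n c ≤ 1 / 2) (n : ℕ) (x : Lattice d) :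
    green (periodized ω N) i n x ≤ 2 * ∑ k ∈ Finset.range (R + 1), paraboloidBound d k := by
  have hb : BddAbove (Set.range fun x => green (periodized ω N) i n x) :=
    ⟨n, by rintro _ ⟨x, rfl⟩; exact green_le _ _ _ _⟩
  -- The supremum is finite because `green` is at most `n`. The comparison reads `s ≤ B + s / 2`, so
  -- `s ≤ 2 B` independently of `n`.
  set s := ⨆ x, green (periodized ω N) i n x with hs
  have hle : ∀ x, green (periodized ω N) i n x ≤ s := fun x => le_ciSup hb x
  have hs0 : 0 ≤ s := (green_nonneg _ i n x).trans (hle x)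
  have h1 : ∀ y, green (periodized ω N) i n y ≤
      ∑ k ∈ Finset.range (R + 1), paraboloidBound d k + s * (1 / 2) := by
    intro y
    rw [green_fold hN hω]
    have hc := fold_mem_cube hN y
    refine (green_center_le hN hω hc hR n hle).trans ?_
    rw [Finset.sum_range_succ', add_comm (paraboloidBound d 0)]
    refine add_le_add (add_le_add (Finset.sum_le_sum fun k _ => ?_) le_rfl)
      (mul_le_mul_of_nonneg_left (hreach _ hc n) hs0)
    exact mul_le_of_le_one_right (paraboloidBound_nonneg _ _) (reach_le_one _ _ _)
  have h2 : s ≤ ∑ k ∈ Finset.range (R + 1), paraboloidBound d k + s * (1 / 2) := ciSup_le h1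
  linarith [hle x]

end

/-! ### Annealed exit probabilities -/

/-- Filling the other coordinates with a fixed point exhibits each function as a function of its own
finite block, and disjoint blocks of a product measure are independent. -/
lemma indepFun_of_dependsOn {ι X : Type*} [MeasurableSpace X] {ν : Measure X}
    [IsProbabilityMeasure ν] {f g : (ι → X) → ℝ} (hf : Measurable f) (hg : Measurable g)
    {S T : Finset ι} (hST : Disjoint S T) (hfS : DependsOn f S) (hgT : DependsOn g T) :
    IndepFun f g (Measure.infinitePi fun _ : ι => ν) := by
  classical
  obtain ⟨x₀⟩ : Nonempty X := nonempty_of_isProbabilityMeasure ν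
  have h := iIndepFun.indepFun_finset S T hST
    (iIndepFun_infinitePi (P := fun _ : ι => ν) (X := fun _ x => x) fun _ => measurable_id)
    (fun i => measurable_pi_apply i)
  have hF : ∀ (U : Finset ι) {k : (ι → X) → ℝ}, DependsOn k U →
      k = (fun x => k (Function.updateFinset (fun _ => x₀) U x)) ∘ fun ω (i : U) => ω i := by
    intro U k hk
    funext ω
    refine hk fun i hi => ?_
    simp only [Function.updateFinset, Finset.mem_coe.1 hi, dif_pos]
  rw [hF S hfS, hF T hgT]
  exact h.comp (hf.comp measurable_updateFinset) (hg.comp measurable_updateFinset)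

section

variable {d N : ℕ} {i : Fin d} {c : Lattice d}

/-- The sites of the cube at distance at most `r` from `c`. -/
noncomputable def siteBox {d : ℕ} (N : ℕ) (c : Lattice d) (r : ℕ) : Finset (Lattice d) :=
  (cube d N).filter fun y => ∀ j, |y j - c j| ≤ (r : ℤ)

lemma fold_mem_siteBox (hN : 0 < N) {r : ℕ} {x : Lattice d} :
    fold N x ∈ siteBox N c r ↔ Near N c r x := by
  simp [siteBox, fold_mem_cube hN, Near]

lemma siteBox_mono {r r' : ℕ} (h : r ≤ r') : siteBox N c r ⊆ siteBox N c r' := by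
  intro y hy
  rw [siteBox, Finset.mem_filter] at hy ⊢
  exact ⟨hy.1, fun j => (hy.2 j).trans (by exact_mod_cast h)⟩

lemma dependsOn_reach (hN : 0 < N) (r n : ℕ) (x : Lattice d) :
    DependsOn (fun ω : Env d => reach ω N i c r n x) (siteBox N c r) := by
  intro ω ω' h
  simp only
  induction n generalizing x with
  | zero => rfl
  | succ n ih =>
    by_cases hx : Near N c r x
    · rw [reach_succ hx, reach_succ hx, h _ ((fold_mem_siteBox hN).2 hx)]
      simp only [ih]
    · rw [reach_of_not_near hx, reach_of_not_near hx]

lemma measurable_jump (y : Lattice d) (e : Dir d) : Measurable fun ω : Env d => (ω y).1 e :=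
  (measurable_pi_apply e).comp (measurable_subtype_coe.comp (measurable_pi_apply y))

lemma measurable_reach (r n : ℕ) (x : Lattice d) :
    Measurable (fun ω : Env d => reach ω N i c r n x) := by
  induction n generalizing x with
  | zero => simp only [reach]; exact measurable_const
  | succ n ih =>
    by_cases hx : Near N c r x
    · simp only [reach_succ hx]
      refine Finset.measurable_sum _ fun e _ => ?_
      split_ifs
      · exact measurable_const
      · exact (measurable_jump _ _).mul (ih _)
    · simp only [reach_of_not_near hx]
      exact measurable_const

/-- The probability that a single jump does not change coordinate `i`. -/
def stayProb {d : ℕ} (i : Fin d) (p : LocalEnv d) : ℝ := ∑ e, if e.1 = i then 0 else p.1 e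

lemma stayProb_nonneg (i : Fin d) (p : LocalEnv d) : 0 ≤ stayProb i p :=
  Finset.sum_nonneg fun e _ => by
    split_ifs
    · exact le_rfl
    · exact jump_nonneg _ _

lemma stayProb_add_le (i : Fin d) (p : LocalEnv d) : stayProb i p + p.1 (i, 1) ≤ 1 := by
  rw [← sum_jump p, stayProb, ← Finset.add_sum_erase _ _ (Finset.mem_univ ((i, 1) : Dir d)),
    ← Finset.add_sum_erase Finset.univ p.1 (Finset.mem_univ ((i, 1) : Dir d)), if_pos rfl,
    zero_add, add_comm]
  refine add_le_add le_rfl (Finset.sum_le_sum fun e _ => ?_)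
  split_ifs
  · exact jump_nonneg _ _
  · exact le_rfl

lemma stayProb_le_one (i : Fin d) (p : LocalEnv d) : stayProb i p ≤ 1 := by
  linarith [stayProb_add_le i p, jump_nonneg p (i, 1)]

lemma measurable_stayProb (i : Fin d) : Measurable (stayProb i) := by
  refine Finset.measurable_sum _ fun e _ => ?_
  split_ifs
  · exact measurable_const
  · exact (measurable_pi_apply e).comp measurable_subtype_coe

variable (ν : Measure (LocalEnv d))

/-- The annealed probability that the walk does not move in coordinate `i` at a new site. -/
noncomputable def meanStay (i : Fin d) : ℝ := ∫ p, stayProb i p ∂ν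

lemma meanStay_nonneg (i : Fin d) : 0 ≤ meanStay ν i :=
  integral_nonneg fun p => stayProb_nonneg i p

variable [IsProbabilityMeasure ν]

instance : IsProbabilityMeasure (envLaw ν) := by
  unfold envLaw
  infer_instance

lemma integrable_of_bounds {Ω : Type*} [MeasurableSpace Ω] {μ : Measure Ω} [IsFiniteMeasure μ]
    {f : Ω → ℝ} (hf : Measurable f) (h0 : ∀ ω, 0 ≤ f ω) (h1 : ∀ ω, f ω ≤ 1) : Integrable f μ :=
  Integrable.of_bound hf.aestronglyMeasurable 1 (Eventually.of_forall fun ω => by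
    rw [Real.norm_eq_abs, abs_of_nonneg (h0 ω)]
    exact h1 ω)

/-- If the jump `e_i` had mean probability zero, it would vanish almost surely at all countably many
sites, against genuine dimensionality. -/
lemma meanStay_lt_one
    (hν : ∀ᵐ ω ∂(envLaw ν), IsBalanced ω ∧ IsGenuinelyDDimensional ω) (i : Fin d) :
    meanStay ν i < 1 := by
  have hm : Measurable fun p : LocalEnv d => p.1 (i, 1) :=
    (measurable_pi_apply _).comp measurable_subtype_coe
  have hle1 : ∀ p : LocalEnv d, p.1 (i, 1) ≤ 1 := fun p => by
    linarith [stayProb_add_le i p, stayProb_nonneg i p]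
  have hi : Integrable (fun p : LocalEnv d => p.1 (i, 1)) ν :=
    integrable_of_bounds hm (fun p => jump_nonneg p _) hle1
  have hpos : 0 < ∫ p : LocalEnv d, p.1 (i, 1) ∂ν := by
    refine lt_of_le_of_ne (integral_nonneg fun p => jump_nonneg p _) fun h0 => ?_
    have h1 := (integral_eq_zero_iff_of_nonneg (fun p => jump_nonneg p _) hi).1 h0.symm
    have h2 : ∀ᵐ ω ∂(envLaw ν), ∀ z : Lattice d, (ω z).1 (i, 1) = 0 := by
      rw [ae_all_iff]
      intro z
      exact (measurePreserving_eval_infinitePi (fun _ : Lattice d => ν) z).quasiMeasurePreserving.ae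
        h1
    obtain ⟨ω, h3, h4⟩ := (hν.and h2).exists
    obtain ⟨z, hz⟩ := h3.2 (i, 1)
    exact hz.ne' (h4 z)
  have h2 : meanStay ν i + ∫ p : LocalEnv d, p.1 (i, 1) ∂ν ≤ 1 := by
    rw [meanStay, ← integral_add (integrable_of_bounds (measurable_stayProb i)
      (stayProb_nonneg i) (stayProb_le_one i)) hi]
    refine (integral_mono_of_nonneg (Eventually.of_forall fun p => ?_)
      (integrable_const (1 : ℝ)) (Eventually.of_forall fun p => stayProb_add_le i p)).trans ?_
    · exact add_nonneg (stayProb_nonneg i p) (jump_nonneg p _)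
    · simp
  linarith

lemma integral_stayProb_apply (i : Fin d) (y : Lattice d) :
    ∫ ω, stayProb i (ω y) ∂(envLaw ν) = meanStay ν i := by
  have h := measurePreserving_eval_infinitePi (fun _ : Lattice d => ν) y
  have h1 := integral_map (μ := Measure.infinitePi fun _ : Lattice d => ν)
    h.measurable.aemeasurable (f := stayProb i)
    (measurable_stayProb i).aestronglyMeasurable
  rw [h.map_eq] at h1
  exact h1.symm

/-- `W` stands for the product of the jump weights used so far, and `r` for the radius of the
explored box. At an explored site nothing is gained. On the shell of radius `r + 1` the environment
is independent of `W`, and its average contributes one factor `meanStay ν i`. Each of the `m - r`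
remaining shells has to be crossed. -/
lemma integral_mul_reach_le (hN : 0 < N) (m n r : ℕ) (hr : r ≤ m) {x : Lattice d}
    (hx : Near N c (r + 1) x) {W : Env d → ℝ} (hW : Measurable W) (hW0 : ∀ ω, 0 ≤ W ω)
    (hW1 : ∀ ω, W ω ≤ 1) (hWd : DependsOn W (siteBox N c r)) :
    ∫ ω, W ω * reach ω N i c m n x ∂(envLaw ν) ≤
      meanStay ν i ^ (m - r) * ∫ ω, W ω ∂(envLaw ν) := by
  have hfar : ∀ (n r : ℕ), r ≤ m → ∀ x, Near N c (r + 1) x → ¬ Near N c m x →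
      ∀ {W : Env d → ℝ}, ∫ ω, W ω * reach ω N i c m n x ∂(envLaw ν) ≤
      meanStay ν i ^ (m - r) * ∫ ω, W ω ∂(envLaw ν) := by
    intro n r hr x hx hxm W
    obtain rfl : r = m := by
      by_contra h
      exact hxm (hx.mono (by lia))
    simp [reach_of_not_near hxm]
  induction n generalizing r x W with
  | zero =>
    by_cases hxm : Near N c m x
    · simp only [reach, if_pos hxm, mul_zero, integral_zero]
      exact mul_nonneg (pow_nonneg (meanStay_nonneg ν i) _) (integral_nonneg hW0)
    · exact hfar 0 r hr x hx hxm
  | succ n ih =>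
    by_cases hxm : Near N c m x
    swap
    · exact hfar (n + 1) r hr x hx hxm
    have hjm := fun e => measurable_jump (fold N x) e
    have hj1 : ∀ (p : LocalEnv d) e, p.1 e ≤ 1 := fun p e => by
      rw [← sum_jump p]
      exact Finset.single_le_sum (fun e _ => jump_nonneg p e) (Finset.mem_univ e)
    have hWm : ∀ e, Measurable fun ω : Env d => W ω * (ω (fold N x)).1 e :=
      fun e => hW.mul (hjm e)
    have hWe0 : ∀ e (ω : Env d), 0 ≤ W ω * (ω (fold N x)).1 e :=
      fun e ω => mul_nonneg (hW0 ω) (jump_nonneg _ _)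
    have hWe1 : ∀ e (ω : Env d), W ω * (ω (fold N x)).1 e ≤ 1 :=
      fun e ω => mul_le_one₀ (hW1 ω) (jump_nonneg _ _) (hj1 _ _)
    -- one step of the walk, the revealed region being the box of radius `r'`
    have hstep : ∀ r', r' ≤ m → Near N c r' x → DependsOn W (siteBox N c r') →
        ∫ ω, W ω * reach ω N i c m (n + 1) x ∂(envLaw ν) ≤
        meanStay ν i ^ (m - r') * ∫ ω, W ω * stayProb i (ω (fold N x)) ∂(envLaw ν) := by
      intro r' hr' hx' hWd'
      have h1 : ∀ ω, W ω * reach ω N i c m (n + 1) x = ∑ e : Dir d, if e.1 = i then 0 else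
          (W ω * (ω (fold N x)).1 e) * reach ω N i c m n (x + e.vec) := by
        intro ω
        rw [reach_succ hxm, Finset.mul_sum]
        refine Finset.sum_congr rfl fun e _ => ?_
        split_ifs
        · rw [mul_zero]
        · rw [mul_assoc]
      have h2 : ∀ ω, W ω * stayProb i (ω (fold N x)) = ∑ e : Dir d, if e.1 = i then 0 else
          W ω * (ω (fold N x)).1 e := by
        intro ω
        rw [stayProb, Finset.mul_sum]
        refine Finset.sum_congr rfl fun e _ => ?_
        split_ifs
        · rw [mul_zero]
        · rfl
      simp only [h1, h2]
      rw [integral_finsetSum, integral_finsetSum, Finset.mul_sum]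
      · refine Finset.sum_le_sum fun e _ => ?_
        by_cases he : e.1 = i
        · simp [he]
        · simp only [he, if_false]
          refine ih r' hr' (hx'.add_vec hN e) (hWm e) (hWe0 e) (hWe1 e) fun ω ω' h => ?_
          rw [hWd' h, h _ ((fold_mem_siteBox hN).2 hx')]
      · intro e _
        split_ifs
        · exact integrable_zero _ _ _
        · exact integrable_of_bounds (hWm e) (hWe0 e) (hWe1 e)
      · intro e _
        split_ifs
        · exact integrable_zero _ _ _
        · exact integrable_of_bounds ((hWm e).mul (measurable_reach _ _ _))
            (fun ω => mul_nonneg (hWe0 e ω) (reach_nonneg _ _ _))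
            (fun ω => mul_le_one₀ (hWe1 e ω) (reach_nonneg _ _ _) (reach_le_one _ _ _))
    have hsm : Measurable fun ω : Env d => stayProb i (ω (fold N x)) :=
      (measurable_stayProb i).comp (measurable_pi_apply _)
    by_cases hxr : Near N c r x
    · refine (hstep r hr hxr hWd).trans (mul_le_mul_of_nonneg_left ?_
        (pow_nonneg (meanStay_nonneg ν i) _))
      refine integral_mono (integrable_of_bounds (hW.mul hsm)
        (fun ω => mul_nonneg (hW0 ω) (stayProb_nonneg i _))
        (fun ω => mul_le_one₀ (hW1 ω) (stayProb_nonneg i _) (stayProb_le_one i _)))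
        (integrable_of_bounds hW hW0 hW1) fun ω => ?_
      exact mul_le_of_le_one_right (hW0 ω) (stayProb_le_one i _)
    · have hrm : r + 1 ≤ m := by
        by_contra h
        exact hxr (hxm.mono (by lia))
      refine (hstep (r + 1) hrm hx fun ω ω' h => hWd fun y hy =>
        h y (siteBox_mono r.le_succ hy)).trans_eq ?_
      have hind : IndepFun W (fun ω : Env d => stayProb i (ω (fold N x))) (envLaw ν) := by
        refine indepFun_of_dependsOn hW hsm (S := siteBox N c r) (T := {fold N x}) ?_ hWd ?_
        · rw [Finset.disjoint_singleton_right, fold_mem_siteBox hN]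
          exact hxr
        · intro ω ω' h
          simp only
          rw [h (fold N x) (by simp)]
      have h3 := hind.integral_fun_mul_eq_mul_integral hW.aestronglyMeasurable
        hsm.aestronglyMeasurable
      rw [h3, integral_stayProb_apply, show m - r = m - (r + 1) + 1 by lia, pow_succ]
      ring

/-- Annealed exit probabilities decay geometrically. -/
lemma integral_reach_le (hN : 0 < N) (hc : c ∈ cube d N) (m n : ℕ) :
    ∫ ω, reach ω N i c m n c ∂(envLaw ν) ≤ meanStay ν i ^ m := by
  have h := integral_mul_reach_le (i := i) ν hN m n 0 (Nat.zero_le m) (near_self hc 1)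
    (W := fun _ => 1) measurable_const (fun _ => zero_le_one) (fun _ => le_rfl)
    (fun _ _ _ => rfl)
  simpa using h

end

/-! ### Spatial averages of exit probabilities -/

section

variable {d N : ℕ}

lemma card_cube (d N : ℕ) : (cube d N).card = N ^ d := by
  simp [cube]

lemma card_filter_near_le (s : Finset (Lattice d)) (c : Lattice d) (r : ℕ) :
    (s.filter fun y => ∀ j, |c j - y j| ≤ (r : ℤ)).card ≤ (2 * r + 1) ^ d := by
  have h : (s.filter fun y => ∀ j, |c j - y j| ≤ (r : ℤ)) ⊆
      Fintype.piFinset fun j => Finset.Icc (c j - r) (c j + r) := by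
    intro y hy
    rw [Fintype.mem_piFinset]
    intro j
    have := abs_le.1 ((Finset.mem_filter.1 hy).2 j)
    rw [Finset.mem_Icc]
    lia
  refine (Finset.card_le_card h).trans_eq ?_
  rw [Fintype.card_piFinset]
  simp only [Int.card_Icc]
  rw [Finset.prod_congr rfl fun j _ => (by lia : (c j + r + 1 - (c j - r)).toNat = 2 * r + 1)]
  simp

lemma disjoint_siteBox {c c' : Lattice d} {r : ℕ} (h : ¬ ∀ j, |c j - c' j| ≤ ((2 * r : ℕ) : ℤ)) :
    Disjoint (siteBox N c r) (siteBox N c' r) := by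
  rw [Finset.disjoint_left]
  intro y h1 h2
  refine h fun j => ?_
  have h3 := abs_le.1 ((Finset.mem_filter.1 h1).2 j)
  have h4 := abs_le.1 ((Finset.mem_filter.1 h2).2 j)
  rw [abs_le]
  push_cast
  constructor <;> linarith

variable (ν : Measure (LocalEnv d)) [IsProbabilityMeasure ν] (i : Fin d)

lemma memLp_reach (c : Lattice d) (m n : ℕ) (x : Lattice d) :
    MemLp (fun ω : Env d => reach ω N i c m n x) 2 (envLaw ν) :=
  MemLp.of_bound (measurable_reach _ _ _).aestronglyMeasurable 1
    (Eventually.of_forall fun ω => by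
      rw [Real.norm_eq_abs, abs_of_nonneg (reach_nonneg _ _ _)]
      exact reach_le_one _ _ _)

/-- Distant centres use disjoint boxes. For close ones the covariance is at most the mean of one
factor; keeping this geometric bound instead of `1` makes the Chebyshev estimates summable over `m`.
-/
lemma covariance_reach_le (hN : 0 < N) {c : Lattice d} (hc : c ∈ cube d N) (c' : Lattice d)
    (m n : ℕ) : cov[fun ω => reach ω N i c m n c, fun ω => reach ω N i c' m n c'; envLaw ν] ≤
      if ∀ j, |c j - c' j| ≤ ((2 * m : ℕ) : ℤ) then meanStay ν i ^ m else 0 := by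
  have h1 := memLp_reach (N := N) ν i c m n c
  have h2 := memLp_reach (N := N) ν i c' m n c'
  split_ifs with h
  · rw [covariance_eq_sub h1 h2]
    have h3 : 0 ≤ (∫ ω, reach ω N i c m n c ∂(envLaw ν)) *
        ∫ ω, reach ω N i c' m n c' ∂(envLaw ν) :=
      mul_nonneg (integral_nonneg fun ω => reach_nonneg _ _ _)
        (integral_nonneg fun ω => reach_nonneg _ _ _)
    refine (sub_le_self _ h3).trans (le_trans ?_ (integral_reach_le ν hN hc m n))
    refine integral_mono_of_nonneg (Eventually.of_forall fun ω =>
      mul_nonneg (reach_nonneg _ _ _) (reach_nonneg _ _ _))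
      (h1.integrable one_le_two) (Eventually.of_forall fun ω =>
        mul_le_of_le_one_right (reach_nonneg _ _ _) (reach_le_one _ _ _))
  · refine (IndepFun.covariance_eq_zero ?_ h1 h2).le
    exact indepFun_of_dependsOn (measurable_reach _ _ _) (measurable_reach _ _ _)
      (disjoint_siteBox h) (dependsOn_reach hN _ _ _) (dependsOn_reach hN _ _ _)

lemma variance_sum_reach_le (hN : 0 < N) (m n : ℕ) :
    Var[fun ω => ∑ c ∈ cube d N, reach ω N i c m n c; envLaw ν] ≤
      (N : ℝ) ^ d * ((4 * m + 1 : ℝ) ^ d * meanStay ν i ^ m) := by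
  rw [variance_fun_sum' fun c _ => memLp_reach ν i c m n c]
  have h : ∀ c ∈ cube d N, ∑ c' ∈ cube d N,
      cov[fun ω => reach ω N i c m n c, fun ω => reach ω N i c' m n c'; envLaw ν] ≤
      (4 * m + 1 : ℝ) ^ d * meanStay ν i ^ m := by
    intro c hc
    refine (Finset.sum_le_sum fun c' _ => covariance_reach_le ν i hN hc c' m n).trans ?_
    rw [← Finset.sum_filter, Finset.sum_const, nsmul_eq_mul]
    refine mul_le_mul_of_nonneg_right ?_ (pow_nonneg (meanStay_nonneg ν i) _)
    have := card_filter_near_le (cube d N) c (2 * m)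
    rw [show 2 * (2 * m) + 1 = 4 * m + 1 by ring] at this
    exact_mod_cast this
  refine (Finset.sum_le_sum h).trans_eq ?_
  rw [Finset.sum_const, nsmul_eq_mul, card_cube]
  push_cast
  ring

/-- Chebyshev, the mean being at most half the threshold. The events increase with `n`, so the union
over `n` costs nothing. -/
lemma measure_sum_reach_gt_le (hN : 0 < N) {t : ℝ} (ht : 0 < t) (m : ℕ)
    (htm : meanStay ν i ^ m ≤ t) :
    envLaw ν {ω | ∃ n, 2 * t * (N : ℝ) ^ d < ∑ c ∈ cube d N, reach ω N i c m n c} ≤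
      ENNReal.ofReal ((4 * m + 1 : ℝ) ^ d * meanStay ν i ^ m / t ^ 2 * (1 / (N : ℝ) ^ d)) := by
  have hNd : (0 : ℝ) < (N : ℝ) ^ d := by positivity
  have h1 : {ω | ∃ n, 2 * t * (N : ℝ) ^ d < ∑ c ∈ cube d N, reach ω N i c m n c} =
      ⋃ n, {ω | 2 * t * (N : ℝ) ^ d < ∑ c ∈ cube d N, reach ω N i c m n c} := by
    ext ω; simp
  have hmono : Monotone fun n => {ω | 2 * t * (N : ℝ) ^ d <
      ∑ c ∈ cube d N, reach ω N i c m n c} :=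
    monotone_nat_of_le_succ fun n ω hω => lt_of_lt_of_le hω
      (Finset.sum_le_sum fun c _ => reach_le_succ m n c)
  rw [h1, hmono.measure_iUnion]
  refine iSup_le fun n => ?_
  have hL : MemLp (fun ω => ∑ c ∈ cube d N, reach ω N i c m n c) 2 (envLaw ν) :=
    memLp_finsetSum _ fun c _ => memLp_reach ν i c m n c
  have hE : ∫ ω, ∑ c ∈ cube d N, reach ω N i c m n c ∂(envLaw ν) ≤ t * (N : ℝ) ^ d := by
    rw [integral_finsetSum _ fun c _ => (memLp_reach ν i c m n c).integrable one_le_two]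
    refine (Finset.sum_le_sum fun c hc => (integral_reach_le ν hN hc m n).trans htm).trans_eq ?_
    rw [Finset.sum_const, nsmul_eq_mul, card_cube]
    push_cast
    ring
  have hC := meas_ge_le_variance_div_sq hL (c := t * (N : ℝ) ^ d) (by positivity)
  refine (measure_mono fun ω hω => ?_).trans (hC.trans (ENNReal.ofReal_le_ofReal ?_))
  · have hω' : 2 * t * (N : ℝ) ^ d < ∑ c ∈ cube d N, reach ω N i c m n c := hω
    change t * (N : ℝ) ^ d ≤ _
    refine le_trans ?_ (le_abs_self _)
    linarith
  · rw [div_le_iff₀ (by positivity)]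
    refine (variance_sum_reach_le ν i hN m n).trans_eq ?_
    field_simp

/-- Spatial averages of exit probabilities decay geometrically, almost surely. -/
lemma ae_sum_reach_le (hd : 2 ≤ d)
    (hν : ∀ᵐ ω ∂(envLaw ν), IsBalanced ω ∧ IsGenuinelyDDimensional ω) :
    ∃ l : ℝ, 0 < l ∧ l < 1 ∧ ∀ᵐ ω ∂(envLaw ν), ∀ᶠ N : ℕ in atTop, ∀ m n,
      ∑ c ∈ cube d N, reach ω N i c m n c ≤ 2 * l ^ m * (N : ℝ) ^ d := by
  have hγ0 := meanStay_nonneg ν i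
  have hγ1 := meanStay_lt_one ν hν i
  set γ := meanStay ν i with hγ
  -- With threshold `√β ^ m`, Chebyshev yields a polynomial times `(γ / β) ^ m`, summable because `γ
  -- < β`; and `γ ≤ √β` keeps the means below it. Also `β > 0` when `γ = 0`.
  set β : ℝ := (1 + γ) / 2 with hβ
  have hβ0 : 0 < β := by rw [hβ]; linarith
  have hβ1 : β < 1 := by rw [hβ]; linarith
  have hγβ : γ < β := by rw [hβ]; linarith
  have hl0 : 0 < √β := Real.sqrt_pos.2 hβ0
  have hl1 : √β < 1 := by rw [Real.sqrt_lt' one_pos]; linarith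
  have hl2 : √β ^ 2 = β := Real.sq_sqrt hβ0.le
  have hγl : γ ≤ √β := by nlinarith
  refine ⟨√β, hl0, hl1, ?_⟩
  set B : ℕ → Set (Env d) := fun N => {ω | ∃ m n, 2 * √β ^ m * (N : ℝ) ^ d <
    ∑ c ∈ cube d N, reach ω N i c m n c} with hB
  have hq1 : γ / β < 1 := (div_lt_one hβ0).2 hγβ
  have hq0 : 0 ≤ γ / β := div_nonneg hγ0 hβ0.le
  have hsum : Summable fun m : ℕ => (4 * m + 1 : ℝ) ^ d * (γ / β) ^ m := by
    have h0 := summable_pow_mul_geometric_of_norm_lt_one d (r := γ / β)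
      (by rwa [Real.norm_eq_abs, abs_of_nonneg hq0])
    have h1 : Summable fun m : ℕ => (5 : ℝ) ^ d * ((m : ℝ) ^ d * (γ / β) ^ m) := h0.mul_left _
    refine (summable_nat_add_iff 1).1 (Summable.of_nonneg_of_le (fun m => by positivity)
      (fun m => ?_) ((summable_nat_add_iff 1).2 h1))
    rw [← mul_assoc, ← mul_pow]
    refine mul_le_mul_of_nonneg_right (pow_le_pow_left₀ (by positivity) ?_ d) (by positivity)
    push_cast
    linarith [(Nat.cast_nonneg m : (0 : ℝ) ≤ m)]
  set K : ℝ := ∑' m : ℕ, (4 * m + 1 : ℝ) ^ d * (γ / β) ^ m with hK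
  have hμB : ∀ N, envLaw ν (B N) ≤ ENNReal.ofReal (K * (1 / (N : ℝ) ^ d)) := by
    intro N
    rcases Nat.eq_zero_or_pos N with rfl | hN
    · have : B 0 = ∅ := by
        ext ω
        simp only [hB, Set.mem_ofPred_eq, Set.mem_empty_iff_false, iff_false, not_exists, not_lt]
        intro m n
        have h0 : cube d 0 = ∅ := by
          rw [← Finset.card_eq_zero, card_cube, zero_pow (by lia)]
        simp only [h0, Finset.sum_empty]
        positivity
      rw [this, measure_empty]
      exact zero_le
    · have h1 : B N = ⋃ m, {ω | ∃ n, 2 * √β ^ m * (N : ℝ) ^ d <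
          ∑ c ∈ cube d N, reach ω N i c m n c} := by
        ext ω; simp [hB]
      rw [h1]
      refine (measure_iUnion_le _).trans ?_
      have h2 : ∀ m : ℕ, envLaw ν {ω | ∃ n, 2 * √β ^ m * (N : ℝ) ^ d <
          ∑ c ∈ cube d N, reach ω N i c m n c} ≤
          ENNReal.ofReal ((4 * m + 1 : ℝ) ^ d * (γ / β) ^ m * (1 / (N : ℝ) ^ d)) := by
        intro m
        refine (measure_sum_reach_gt_le ν i hN (pow_pos hl0 m) m
          (pow_le_pow_left₀ hγ0 hγl m)).trans_eq ?_
        rw [← pow_mul, mul_comm m 2, pow_mul, hl2, div_pow γ β m, ← hγ, mul_div_assoc]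
      refine (ENNReal.tsum_le_tsum h2).trans_eq ?_
      rw [← ENNReal.ofReal_tsum_of_nonneg (fun m => by positivity) (hsum.mul_right _),
        tsum_mul_right]
  -- Borel–Cantelli in `N` uses the summability of `N ^ (-d)`, hence `d ≥ 2`. The union over `m` and
  -- `n` is already inside `B N`.
  have hBC : ∑' N, envLaw ν (B N) ≠ ∞ := by
    refine ne_top_of_le_ne_top ?_ (ENNReal.tsum_le_tsum hμB)
    have h3 : Summable fun N : ℕ => K * (1 / (N : ℝ) ^ d) :=
      (Real.summable_one_div_nat_pow.2 (by lia)).mul_left K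
    have hK0 : 0 ≤ K := tsum_nonneg fun m => by positivity
    rw [← ENNReal.ofReal_tsum_of_nonneg (fun N => by positivity) h3]
    exact ENNReal.ofReal_ne_top
  filter_upwards [ae_eventually_notMem hBC] with ω hω
  filter_upwards [hω] with N hN m n
  by_contra h
  exact hN ⟨m, n, not_le.1 h⟩

end

/-! ### Moments of the Green function -/

/-- Jensen for the normalised weights, each of which is then bounded by one. -/
lemma sum_mul_pow_le {ι : Type*} (s : Finset ι) {w y : ι → ℝ} (hw : ∀ k ∈ s, 0 < w k)
    (hy : ∀ k ∈ s, 0 ≤ y k) {q : ℕ} (hq : q ≠ 0) :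
    (∑ k ∈ s, w k * y k) ^ q ≤ (∑ k ∈ s, w k) ^ q * ∑ k ∈ s, y k ^ q := by
  rcases s.eq_empty_or_nonempty with rfl | hs
  · simp [hq]
  have hZ : 0 < ∑ k ∈ s, w k := Finset.sum_pos hw hs
  have h := Real.pow_arith_mean_le_arith_mean_pow s (fun k => w k / ∑ k ∈ s, w k) y
    (fun k hk => div_nonneg (hw k hk).le hZ.le) (by rw [← Finset.sum_div, div_self hZ.ne']) hy q
  have h1 : ∑ k ∈ s, w k * y k = (∑ k ∈ s, w k) * ∑ k ∈ s, w k / (∑ k ∈ s, w k) * y k := by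
    rw [Finset.mul_sum]
    exact Finset.sum_congr rfl fun k _ => by field_simp
  rw [h1, mul_pow]
  refine mul_le_mul_of_nonneg_left (h.trans (Finset.sum_le_sum fun k hk => ?_)) (by positivity)
  refine mul_le_of_le_one_left (pow_nonneg (hy k hk) _) ((div_le_one hZ).2 ?_)
  exact Finset.single_le_sum (fun k hk => (hw k hk).le) hk

lemma summable_succ_pow_mul_geometric (p : ℕ) {r : ℝ} (h0 : 0 < r) (h1 : r < 1) :
    Summable fun k : ℕ => (k + 1 : ℝ) ^ p * r ^ k := by
  have h := (summable_nat_add_iff 1).2 (summable_pow_mul_geometric_of_norm_lt_one p (r := r)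
    (by rwa [Real.norm_eq_abs, abs_of_pos h0]))
  refine (h.mul_left r⁻¹).congr fun k => ?_
  push_cast
  field_simp
  ring

section

variable {d : ℕ}

lemma paraboloidBound_succ_le (k : ℕ) :
    paraboloidBound d (k + 1) ≤ 36 * d * (k + 1 : ℝ) ^ 2 := by
  unfold paraboloidBound
  have hk : (0 : ℝ) ≤ k := Nat.cast_nonneg k
  have : (2 * ((k + 1 : ℕ) : ℝ) + 4) ^ 2 ≤ 36 * (k + 1 : ℝ) ^ 2 := by
    push_cast
    nlinarith
  nlinarith [(Nat.cast_nonneg d : (0 : ℝ) ≤ d)]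

lemma paraboloidBound_mono {k l : ℕ} (h : k ≤ l) : paraboloidBound d k ≤ paraboloidBound d l := by
  unfold paraboloidBound
  gcongr

/-- The uniform bound on `green` is of order `R ^ 3`. Allowing cubic coefficients thus lets the
final exit term join the sum as `k = R`. -/
lemma green_center_le_sum {N : ℕ} {ω : Env d} {i : Fin d} (hN : 0 < N) (hω : IsBalanced ω) {R : ℕ}
    (hR : 2 * R + 1 < N) (hreach : ∀ c ∈ cube d N, ∀ n, reach ω N i c R n c ≤ 1 / 2)
    {c : Lattice d} (hc : c ∈ cube d N) (n : ℕ) :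
    green (periodized ω N) i n c ≤ paraboloidBound d 0 +
      ∑ k ∈ Finset.range (R + 1), 72 * d * (k + 1 : ℝ) ^ 3 * reach ω N i c k n c := by
  have h1 := green_center_le hN hω hc hR n (green_le_of_reach_le hN hω hR hreach n)
  refine h1.trans ?_
  rw [add_assoc, Finset.sum_range_succ fun k : ℕ => 72 * d * (k + 1 : ℝ) ^ 3 * reach ω N i c k n c]
  have hd0 : (0 : ℝ) ≤ d := Nat.cast_nonneg d
  refine add_le_add le_rfl (add_le_add (Finset.sum_le_sum fun k _ => ?_) ?_)
  · refine mul_le_mul_of_nonneg_right ((paraboloidBound_succ_le k).trans ?_) (reach_nonneg _ _ _)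
    have hk : (1 : ℝ) ≤ k + 1 := by linarith [(Nat.cast_nonneg k : (0 : ℝ) ≤ k)]
    have : (k + 1 : ℝ) ^ 2 ≤ (k + 1 : ℝ) ^ 3 := pow_le_pow_right₀ hk (by norm_num)
    nlinarith [mul_le_mul_of_nonneg_left this hd0, mul_nonneg hd0 (sq_nonneg (k + 1 : ℝ))]
  · refine mul_le_mul_of_nonneg_right ?_ (reach_nonneg _ _ _)
    have h2 : ∑ k ∈ Finset.range (R + 1), paraboloidBound d k ≤
        ∑ _k ∈ Finset.range (R + 1), paraboloidBound d (R + 1) :=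
      Finset.sum_le_sum fun k hk => paraboloidBound_mono (Finset.mem_range.1 hk).le
    rw [Finset.sum_const, Finset.card_range, nsmul_eq_mul] at h2
    have h3 := mul_le_mul_of_nonneg_left (paraboloidBound_succ_le (d := d) R)
      (by positivity : (0 : ℝ) ≤ ((R + 1 : ℕ) : ℝ))
    push_cast at h2 h3
    linarith

/-- Writing the decay rate as `ρ ^ (2 * q)` lets one factor `(ρ ^ q) ^ k` pay for the weights `ρ ^
k` in `sum_mul_pow_le`, while the other sums against the polynomial. As `0 ≤ reach ≤ 1`, its first
spatial moment controls all higher ones. -/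
lemma sum_green_pow_le {N : ℕ} {ω : Env d} {i : Fin d} (hN : 0 < N) (hω : IsBalanced ω) {R : ℕ}
    (hR : 2 * R + 1 < N) (hreach : ∀ c ∈ cube d N, ∀ n, reach ω N i c R n c ≤ 1 / 2)
    {q : ℕ} (hq : q ≠ 0) {ρ : ℝ} (hρ0 : 0 < ρ) (hρ1 : ρ < 1)
    (hsum : ∀ m n, ∑ c ∈ cube d N, reach ω N i c m n c ≤ 2 * (ρ ^ (2 * q)) ^ m * (N : ℝ) ^ d)
    (n : ℕ) :
    ∑ c ∈ cube d N, green (periodized ω N) i n c ^ q ≤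
      2 ^ (q - 1) * (paraboloidBound d 0 ^ q + (∑' k : ℕ, ρ ^ k) ^ q *
        ∑' k : ℕ, 2 * (72 * d) ^ q * ((k + 1 : ℝ) ^ (3 * q) * (ρ ^ q) ^ k)) * (N : ℝ) ^ d := by
  have hρq1 : ρ ^ q < 1 := pow_lt_one₀ hρ0.le hρ1 hq
  have hS : Summable fun k : ℕ => 2 * (72 * d : ℝ) ^ q * ((k + 1 : ℝ) ^ (3 * q) * (ρ ^ q) ^ k) :=
    (summable_succ_pow_mul_geometric (3 * q) (pow_pos hρ0 q) hρq1).mul_left _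
  have hG : Summable fun k : ℕ => ρ ^ k := summable_geometric_of_lt_one hρ0.le hρ1
  have hpt : ∀ c ∈ cube d N, green (periodized ω N) i n c ^ q ≤
      2 ^ (q - 1) * (paraboloidBound d 0 ^ q + (∑' k : ℕ, ρ ^ k) ^ q *
      ∑ k ∈ Finset.range (R + 1), (72 * d) ^ q * (k + 1 : ℝ) ^ (3 * q) / (ρ ^ q) ^ k *
        reach ω N i c k n c) := by
    intro c hc
    have h1 := green_center_le_sum hN hω hR hreach hc n
    have hy : ∀ k : ℕ, 0 ≤ 72 * d * (k + 1 : ℝ) ^ 3 / ρ ^ k * reach ω N i c k n c :=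
      fun k => mul_nonneg (by positivity) (reach_nonneg _ _ _)
    have h2 : ∑ k ∈ Finset.range (R + 1), 72 * d * (k + 1 : ℝ) ^ 3 * reach ω N i c k n c =
        ∑ k ∈ Finset.range (R + 1), ρ ^ k * (72 * d * (k + 1 : ℝ) ^ 3 / ρ ^ k *
          reach ω N i c k n c) := Finset.sum_congr rfl fun k _ => by field_simp
    rw [h2] at h1
    have h3 : 0 ≤ ∑ k ∈ Finset.range (R + 1), ρ ^ k * (72 * d * (k + 1 : ℝ) ^ 3 / ρ ^ k *
        reach ω N i c k n c) := Finset.sum_nonneg fun k _ => mul_nonneg (by positivity) (hy k)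
    refine (pow_le_pow_left₀ (green_nonneg _ _ _ _) h1 q).trans
      ((add_pow_le (paraboloidBound_nonneg _ _) h3 q).trans ?_)
    refine mul_le_mul_of_nonneg_left (add_le_add le_rfl ?_) (by positivity)
    refine (sum_mul_pow_le _ (fun k _ => pow_pos hρ0 k) (fun k _ => hy k) hq).trans ?_
    refine mul_le_mul (pow_le_pow_left₀ (Finset.sum_nonneg fun k _ => by positivity)
      (hG.sum_le_tsum _ fun k _ => by positivity) q) (Finset.sum_le_sum fun k _ => ?_)
      (Finset.sum_nonneg fun k _ => pow_nonneg (hy k) q) (pow_nonneg (tsum_nonneg fun k => by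
        positivity) q)
    rw [mul_pow, div_pow, mul_pow, ← pow_mul, ← pow_mul, ← pow_mul, mul_comm k q]
    refine mul_le_mul_of_nonneg_left ?_ (by positivity)
    exact pow_le_of_le_one (reach_nonneg _ _ _) (reach_le_one _ _ _) hq
  have hsum' : ∑ c ∈ cube d N, ∑ k ∈ Finset.range (R + 1),
      (72 * d) ^ q * (k + 1 : ℝ) ^ (3 * q) / (ρ ^ q) ^ k * reach ω N i c k n c ≤
      (∑' k : ℕ, 2 * (72 * d) ^ q * ((k + 1 : ℝ) ^ (3 * q) * (ρ ^ q) ^ k)) * (N : ℝ) ^ d := by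
    rw [Finset.sum_comm]
    refine le_trans (Finset.sum_le_sum (g := fun k : ℕ => 2 * (72 * d : ℝ) ^ q *
      ((k + 1 : ℝ) ^ (3 * q) * (ρ ^ q) ^ k) * (N : ℝ) ^ d) fun k _ => ?_) ?_
    · rw [← Finset.mul_sum]
      refine (mul_le_mul_of_nonneg_left (hsum k n) (by positivity)).trans_eq ?_
      rw [show (ρ ^ (2 * q)) ^ k = (ρ ^ q) ^ k * (ρ ^ q) ^ k by
        rw [← mul_pow, ← pow_add, two_mul]]
      field_simp
    · rw [← Finset.sum_mul]
      exact mul_le_mul_of_nonneg_right (hS.sum_le_tsum _ fun k _ => by positivity) (by positivity)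
  refine (Finset.sum_le_sum hpt).trans ?_
  rw [← Finset.mul_sum, Finset.sum_add_distrib, ← Finset.mul_sum, Finset.sum_const, card_cube,
    nsmul_eq_mul, mul_assoc]
  refine mul_le_mul_of_nonneg_left ?_ (by positivity)
  rw [add_mul]
  push_cast
  refine add_le_add (mul_comm _ _).le ?_
  rw [mul_assoc]
  exact mul_le_mul_of_nonneg_left hsum' (pow_nonneg (tsum_nonneg fun k => by positivity) q)

variable (ν : Measure (LocalEnv d)) [IsProbabilityMeasure ν]

lemma ae_sum_green_pow_le (hd : 2 ≤ d) {q : ℕ} (hq : q ≠ 0)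
    (hν : ∀ᵐ ω ∂(envLaw ν), IsBalanced ω ∧ IsGenuinelyDDimensional ω) (i : Fin d) :
    ∃ A : ℝ, 0 ≤ A ∧ ∀ᵐ ω ∂(envLaw ν), ∀ᶠ N : ℕ in atTop, ∀ n,
      ∑ c ∈ cube d N, green (periodized ω N) i n c ^ q ≤ A * (N : ℝ) ^ d := by
  obtain ⟨l, hl0, hl1, hl⟩ := ae_sum_reach_le ν i hd hν
  set ρ : ℝ := l ^ (1 / ((2 * q : ℕ) : ℝ)) with hρ
  have h2q : 2 * q ≠ 0 := by lia
  have hρ0 : 0 < ρ := Real.rpow_pos_of_pos hl0 _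
  have hρ1 : ρ < 1 := Real.rpow_lt_one hl0.le hl1 (by positivity)
  have hρl : ρ ^ (2 * q) = l := by
    rw [hρ, one_div]
    exact Real.rpow_inv_natCast_pow hl0.le h2q
  refine ⟨2 ^ (q - 1) * (paraboloidBound d 0 ^ q + (∑' k : ℕ, ρ ^ k) ^ q *
        ∑' k : ℕ, 2 * (72 * d) ^ q * ((k + 1 : ℝ) ^ (3 * q) * (ρ ^ q) ^ k)), ?_, ?_⟩
  · have h1 := paraboloidBound_nonneg d 0
    have h2 : 0 ≤ ∑' k : ℕ, ρ ^ k := tsum_nonneg fun k => by positivity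
    have h3 : 0 ≤ ∑' k : ℕ, 2 * (72 * d : ℝ) ^ q * ((k + 1 : ℝ) ^ (3 * q) * (ρ ^ q) ^ k) :=
      tsum_nonneg fun k => by positivity
    positivity
  have hlim : Tendsto (fun R : ℕ => 2 * (6 : ℝ) ^ d * ((R + 1 : ℝ) ^ d * l ^ R)) atTop
      (nhds 0) := by
    have := ((summable_succ_pow_mul_geometric d hl0 hl1).tendsto_atTop_zero).const_mul
      (2 * (6 : ℝ) ^ d)
    simpa using this
  have hR : Tendsto (fun N : ℕ => N / 4) atTop atTop :=
    Filter.tendsto_atTop_atTop.2 fun b => ⟨4 * b, fun a ha => by lia⟩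
  have hev := (hlim.comp hR).eventually (gt_mem_nhds (show (0 : ℝ) < 1 / 2 by norm_num))
  filter_upwards [hl, hν] with ω hω hω'
  filter_upwards [hω, hev, eventually_ge_atTop 3] with N hN1 hN2 hN3 n
  rw [← hρl] at hN1
  refine sum_green_pow_le (by lia) hω'.1 (R := N / 4) (by lia) (fun c hc n => ?_) hq hρ0 hρ1 hN1 n
  -- One term is at most the whole sum, and `2 l ^ (N / 4) N ^ d` tends to zero: at this radius the
  -- averaged estimate is already a uniform one.
  refine (Finset.single_le_sum (f := fun c => reach ω N i c (N / 4) n c)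
    (fun c _ => reach_nonneg _ _ _) hc).trans ((hN1 (N / 4) n).trans ?_)
  rw [hρl]
  refine le_trans ?_ hN2.le
  simp only [Function.comp_apply]
  have h1 : (N : ℝ) ≤ 6 * (((N / 4 : ℕ) : ℝ) + 1) := by
    exact_mod_cast (by lia : N ≤ 6 * (N / 4 + 1))
  have h2 := pow_le_pow_left₀ (Nat.cast_nonneg N) h1 d
  rw [mul_pow] at h2
  have h3 := mul_le_mul_of_nonneg_left h2 (show 0 ≤ 2 * l ^ (N / 4) by positivity)
  refine h3.trans_eq (by ring)

/-- The expected time until all coordinates have moved has bounded spatial moments. -/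
lemma exists_expectedTime (hd : 2 ≤ d) {q : ℕ} (hq : q ≠ 0)
    (hν : ∀ᵐ ω ∂(envLaw ν), IsBalanced ω ∧ IsGenuinelyDDimensional ω) :
    ∃ A : ℝ, 0 < A ∧ ∀ᵐ ω ∂(envLaw ν), ∀ᶠ N : ℕ in atTop, ∃ h : Lattice d → ℝ,
      (∀ x, 0 ≤ h x) ∧ (∀ x, h x = h (fold N x)) ∧
      (∀ n x, ∑ i, green (periodized ω N) i n x ≤ h x) ∧
      ∑ c ∈ cube d N, h c ^ q ≤ A * (N : ℝ) ^ d := by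
  choose A hA0 hA using ae_sum_green_pow_le ν hd hq hν
  -- The `+ 1` makes the constant strictly positive; `opening` divides by it.
  refine ⟨(d : ℝ) ^ q * ∑ i, A i + 1, ?_, ?_⟩
  · have : 0 ≤ ∑ i, A i := Finset.sum_nonneg fun i _ => hA0 i
    positivity
  filter_upwards [ae_all_iff.2 hA, hν] with ω hω hω'
  filter_upwards [eventually_all.2 hω, eventually_gt_atTop 0] with N hN hN0
  set g : ℕ → Lattice d → ℝ := fun n x => ∑ i, green (periodized ω N) i n x with hg
  have hg0 : ∀ n x, 0 ≤ g n x := fun n x => Finset.sum_nonneg fun i _ => green_nonneg _ _ _ _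
  have hgm : ∀ x, Monotone fun n => g n x := fun x m n hmn =>
    Finset.sum_le_sum fun i _ => green_mono _ _ hmn x
  have hgf : ∀ n x, g n x = g n (fold N x) := fun n x =>
    Finset.sum_congr rfl fun i _ => green_fold hN0 hω'.1 i n x
  have hsum : ∀ n, ∑ c ∈ cube d N, g n c ^ q ≤ ((d : ℝ) ^ q * ∑ i, A i + 1) * (N : ℝ) ^ d := by
    intro n
    have h1 : ∀ c ∈ cube d N, g n c ^ q ≤
        (d : ℝ) ^ q * ∑ i, green (periodized ω N) i n c ^ q := by
      intro c _
      have := sum_mul_pow_le Finset.univ (w := fun _ : Fin d => (1 : ℝ))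
        (y := fun i => green (periodized ω N) i n c) (fun _ _ => one_pos)
        (fun i _ => green_nonneg _ _ _ _) hq
      simpa [hg] using this
    refine (Finset.sum_le_sum h1).trans ?_
    rw [← Finset.mul_sum, Finset.sum_comm, add_mul, mul_assoc, Finset.sum_mul]
    have h2 := mul_le_mul_of_nonneg_left (Finset.sum_le_sum fun i (_ : i ∈ Finset.univ) => hN i n)
      (show (0 : ℝ) ≤ (d : ℝ) ^ q by positivity)
    have h3 : (0 : ℝ) ≤ 1 * (N : ℝ) ^ d := by positivity
    linarith
  -- For fixed `N` the moment bound, uniform in `n`, also bounds each point, so the supremum over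
  -- `n` can serve as `h`.
  have hbdd : ∀ x, BddAbove (Set.range fun n => g n x) := by
    intro x
    refine ⟨1 + ((d : ℝ) ^ q * ∑ i, A i + 1) * (N : ℝ) ^ d, ?_⟩
    rintro _ ⟨n, rfl⟩
    simp only
    rw [hgf n x]
    have h1 := (Finset.single_le_sum (f := fun c => g n c ^ q)
      (fun c _ => pow_nonneg (hg0 n c) q) (fold_mem_cube hN0 x)).trans (hsum n)
    rcases le_total (g n (fold N x)) 1 with h2 | h2
    · have := (pow_nonneg (hg0 n (fold N x)) q).trans h1
      linarith
    · have := le_self_pow₀ h2 hq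
      linarith
  have hlim : ∀ x, Tendsto (fun n => g n x) atTop (nhds (⨆ n, g n x)) := fun x =>
    tendsto_atTop_ciSup (hgm x) (hbdd x)
  refine ⟨fun x => ⨆ n, g n x, fun x => (hg0 0 x).trans (le_ciSup (hbdd x) 0), fun x => ?_,
    fun n x => le_ciSup (hbdd x) n, ?_⟩
  · simp only [← hgf]
  · exact le_of_tendsto (tendsto_finsetSum _ fun c _ => (hlim c).pow q)
      (Eventually.of_forall hsum)

end

/-! ### The transition operator of the folded rescaled walk -/

/-- The transition operator of the folded rescaled walk, acting on functions on the cube. -/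
noncomputable def foldedOp {d : ℕ} (ω : Env d) (N : ℕ) (u : Lattice d → ℝ) (x : Lattice d) : ℝ :=
  ∑ y ∈ cube d N, (foldedTransition ω N x y).toReal * u y

section

variable {d N : ℕ} {ω : Env d} {h : Lattice d → ℝ}

lemma survival_le_of_green_le
    (hg : ∀ n x, ∑ i, green (periodized ω N) i n x ≤ h x) (i : Fin d) (n : ℕ) (x : Lattice d) :
    survival (periodized ω N) i n x ≤ h x / (n + 1) := by
  refine (survival_le_green_div _ i n x).trans ?_
  gcongr
  exact (Finset.single_le_sum (f := fun i => green (periodized ω N) i (n + 1) x)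
    (fun i _ => green_nonneg _ _ _ _) (Finset.mem_univ i)).trans (hg (n + 1) x)

lemma tendsto_survival (hg : ∀ n x, ∑ i, green (periodized ω N) i n x ≤ h x) (i : Fin d)
    (x : Lattice d) : Tendsto (fun n => survival (periodized ω N) i n x) atTop (nhds 0) := by
  have h1 : Tendsto (fun n : ℕ => h x / ((n : ℝ) + 1)) atTop (nhds 0) := by
    have := (tendsto_one_div_add_atTop_nhds_zero_nat (𝕜 := ℝ)).const_mul (h x)
    simpa [div_eq_mul_inv] using this
  exact squeeze_zero (fun n => survival_nonneg _ _ _ _)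
    (fun n => survival_le_of_green_le hg i n x) h1

lemma tendsto_unfinished (hg : ∀ n x, ∑ i, green (periodized ω N) i n x ≤ h x)
    (x : Lattice d) : Tendsto (fun n => unfinished (periodized ω N) n x) atTop (nhds 0) := by
  have h1 := tendsto_finsetSum Finset.univ fun i (_ : i ∈ Finset.univ) => tendsto_survival hg i x
  rw [Finset.sum_const_zero] at h1
  exact squeeze_zero (fun n => unfinished_nonneg _ _ _) (fun n => unfinished_le _ n x) h1

lemma exists_survival_le (hN : 0 < N) (hfold : ∀ x, h x = h (fold N x))
    (hg : ∀ n x, ∑ i, green (periodized ω N) i n x ≤ h x) (i : Fin d) {ε : ℝ} (hε : 0 < ε) :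
    ∃ n, ∀ x, survival (periodized ω N) i n x ≤ ε := by
  have h0 : ∀ x, 0 ≤ h x := fun x => le_trans (by simp [green]) (hg 0 x)
  set H := ∑ c ∈ cube d N, h c with hH
  obtain ⟨n, hn⟩ := exists_nat_gt (H / ε)
  refine ⟨n, fun x => (survival_le_of_green_le hg i n x).trans ?_⟩
  have h1 : h x ≤ H := by
    rw [hfold x]
    exact Finset.single_le_sum (fun c _ => h0 c) (fold_mem_cube hN x)
  rw [div_lt_iff₀ hε] at hn
  rw [div_le_iff₀ (by positivity)]
  nlinarith

/-- Including the walks not yet stopped changes the expectation by at most `∑ |u|` times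
`unfinished`, which vanishes in the limit. This lets the martingale identities for `stoppedExp` pass
to `foldedOp`. -/
lemma tendsto_stoppedExp_fold [Nonempty (Fin d)] (hN : 0 < N)
    (hg : ∀ n x, ∑ i, green (periodized ω N) i n x ≤ h x) (u : Lattice d → ℝ) (x : Lattice d) :
    Tendsto (fun n => stoppedExp (periodized ω N) (fun x _ => u (fold N x)) n x Finset.univ) atTop
      (nhds (foldedOp ω N u x)) := by
  classical
  have h1 : Tendsto (fun n => ∑ y ∈ cube d N, stoppedExp (periodized ω N)
      (fun x S => if fold N x = y ∧ S = ∅ then 1 else 0) n x Finset.univ * u y) atTop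
      (nhds (foldedOp ω N u x)) := by
    refine tendsto_finsetSum _ fun y _ => Tendsto.mul_const _ ?_
    convert tendsto_stoppedExp_foldedTransition ω N x y
  set U := ∑ y ∈ cube d N, |u y| with hU
  have h2 : ∀ n, |stoppedExp (periodized ω N) (fun x _ => u (fold N x)) n x Finset.univ -
      ∑ y ∈ cube d N, stoppedExp (periodized ω N)
        (fun x S => if fold N x = y ∧ S = ∅ then 1 else 0) n x Finset.univ * u y| ≤
      U * unfinished (periodized ω N) n x := by
    intro n
    have h3 : ∑ y ∈ cube d N, stoppedExp (periodized ω N)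
        (fun x S => if fold N x = y ∧ S = ∅ then 1 else 0) n x Finset.univ * u y =
        stoppedExp (periodized ω N) (fun x S => if S = ∅ then u (fold N x) else 0) n x
          Finset.univ := by
      simp only [mul_comm _ (u _), ← stoppedExp_const_mul]
      rw [← stoppedExp_sum]
      congr 1
      funext x S
      by_cases hS : S = ∅
      · simp [hS, fold_mem_cube hN x]
      · simp [hS]
    rw [h3, ← stoppedExp_sub, unfinished, ← stoppedExp_const_mul, abs_le]
    have hb : ∀ (x : Lattice d), |u (fold N x)| ≤ U := fun x =>
      Finset.single_le_sum (f := fun y => |u y|) (fun _ _ => abs_nonneg _) (fold_mem_cube hN x)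
    constructor
    · rw [neg_eq_neg_one_mul, ← stoppedExp_const_mul]
      refine stoppedExp_mono _ (fun x S => ?_) n x _
      split_ifs
      · simp
      · linarith [neg_abs_le (u (fold N x)), hb x]
    · refine stoppedExp_mono _ (fun x S => ?_) n x _
      split_ifs
      · simp
      · linarith [le_abs_self (u (fold N x)), hb x]
  have h4 := (tendsto_unfinished hg x).const_mul U
  rw [mul_zero] at h4
  have h5 := squeeze_zero_norm (fun n => by rw [Real.norm_eq_abs]; exact h2 n) h4
  simpa using h5.add h1

lemma foldedOp_fold [Nonempty (Fin d)] (hN : 0 < N) (hω : IsBalanced ω)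
    (hg : ∀ n x, ∑ i, green (periodized ω N) i n x ≤ h x) (u : Lattice d → ℝ) (x : Lattice d) :
    foldedOp ω N u x = foldedOp ω N u (fold N x) := by
  refine tendsto_nhds_unique (tendsto_stoppedExp_fold hN hg u x) ?_
  refine (tendsto_stoppedExp_fold hN hg u (fold N x)).congr fun n => ?_
  exact stoppedExp_fold hN hω (fun y _ => u y) n (fold_fold hN x) _

lemma foldedOp_one [Nonempty (Fin d)] (hN : 0 < N)
    (hg : ∀ n x, ∑ i, green (periodized ω N) i n x ≤ h x) (x : Lattice d) :
    ∑ y ∈ cube d N, (foldedTransition ω N x y).toReal = 1 := by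
  have h1 := tendsto_stoppedExp_fold hN hg (fun _ => 1) x
  simp only [stoppedExp_const] at h1
  have h2 := tendsto_nhds_unique tendsto_const_nhds h1
  simpa [foldedOp] using h2.symm

end

/-! ### The maximum principle -/

section

variable {d : ℕ}

/-- The sum of a paraboloid with opening `a` and a linear function of slope `s`. -/
def tiltedParaboloid (a : ℝ) (x₀ : Lattice d) (s : Fin d → ℝ) (x : Lattice d) : ℝ :=
  ∑ j, (a * ((x j : ℝ) - x₀ j) ^ 2 + s j * ((x j : ℝ) - x₀ j))

lemma tiltedParaboloid_add_vec (a : ℝ) (x₀ : Lattice d) (s : Fin d → ℝ) (x : Lattice d)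
    (e : Dir d) : tiltedParaboloid a x₀ s (x + e.vec) = tiltedParaboloid a x₀ s x +
      (e.2 : ℤ) * (2 * a * ((x e.1 : ℝ) - x₀ e.1) + s e.1) + a := by
  unfold tiltedParaboloid
  rw [← Finset.add_sum_erase _ _ (Finset.mem_univ e.1),
    ← Finset.add_sum_erase Finset.univ (fun j => a * ((x j : ℝ) - x₀ j) ^ 2 +
      s j * ((x j : ℝ) - x₀ j)) (Finset.mem_univ e.1),
    Finset.sum_congr rfl (fun k hk => by rw [add_vec_apply_ne x e (Finset.ne_of_mem_erase hk)]),
    add_vec_apply_self]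
  rcases Int.units_eq_one_or e.2 with h | h <;> rw [h] <;> push_cast <;> ring

lemma tiltedParaboloid_sub (a : ℝ) (x₀ : Lattice d) (s s' : Fin d → ℝ) (x z : Lattice d) :
    (tiltedParaboloid a x₀ s x - tiltedParaboloid a x₀ s z) -
      (tiltedParaboloid a x₀ s' x - tiltedParaboloid a x₀ s' z) =
      tiltedParaboloid 0 z (fun j => s j - s' j) x := by
  simp only [tiltedParaboloid, ← Finset.sum_sub_distrib]
  exact Finset.sum_congr rfl fun j _ => by ring

lemma tiltedParaboloid_self (a : ℝ) (x₀ : Lattice d) (s : Fin d → ℝ) :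
    tiltedParaboloid a x₀ s x₀ = 0 := by
  simp [tiltedParaboloid]

lemma neg_le_tilted_term {a m t s : ℝ} (ha : 0 ≤ a) (hs : |s| ≤ a * m) :
    -(a * m ^ 2 / 4) ≤ a * t ^ 2 + s * t := by
  have h1 : -(a * m * |t|) ≤ s * t := by
    have h2 := neg_abs_le (s * t)
    rw [abs_mul] at h2
    nlinarith [mul_le_mul_of_nonneg_right hs (abs_nonneg t)]
  have h3 : t ^ 2 = |t| ^ 2 := (sq_abs t).symm
  rw [h3]
  nlinarith [mul_nonneg ha (sq_nonneg (|t| - m / 2))]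

lemma neg_le_tiltedParaboloid {a m : ℝ} (ha : 0 ≤ a) {s : Fin d → ℝ} (hs : ∀ j, |s j| ≤ a * m)
    (x₀ x : Lattice d) : -(d * (a * m ^ 2 / 4)) ≤ tiltedParaboloid a x₀ s x := by
  have h := Finset.sum_le_sum fun (j : Fin d) (_ : j ∈ Finset.univ) =>
    neg_le_tilted_term (t := (x j : ℝ) - x₀ j) ha (hs j)
  simpa [tiltedParaboloid] using h

/-- The far coordinate contributes at least `d (d - 1) a m ^ 2`, more than the other `d - 1` can
lose at `a m ^ 2 / 4` each. -/
lemma tiltedParaboloid_nonneg_of_far {a m : ℝ} (ha : 0 ≤ a) (hm : 0 ≤ m) {s : Fin d → ℝ}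
    (hs : ∀ j, |s j| ≤ a * m) {x₀ x : Lattice d} {k : Fin d}
    (hk : d * m ≤ |(x k : ℝ) - x₀ k|) : 0 ≤ tiltedParaboloid a x₀ s x := by
  unfold tiltedParaboloid
  rw [← Finset.add_sum_erase _ _ (Finset.mem_univ k)]
  have h1 := Finset.sum_le_sum fun (j : Fin d) (_ : j ∈ Finset.univ.erase k) =>
    neg_le_tilted_term (t := (x j : ℝ) - x₀ j) ha (hs j)
  rw [Finset.sum_const, Finset.card_erase_of_mem (Finset.mem_univ k), Finset.card_univ,
    Fintype.card_fin, nsmul_eq_mul] at h1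
  have hd : 1 ≤ d := k.pos
  rw [Nat.cast_sub hd, Nat.cast_one] at h1
  set t := (x k : ℝ) - x₀ k with ht
  have hd' : (1 : ℝ) ≤ d := by exact_mod_cast hd
  have h2 : -(a * m * |t|) ≤ s k * t := by
    have h2 := neg_abs_le (s k * t)
    rw [abs_mul] at h2
    nlinarith [mul_le_mul_of_nonneg_right (hs k) (abs_nonneg t)]
  have h3 : t ^ 2 = |t| ^ 2 := (sq_abs t).symm
  have h4 : (d * m) * ((d - 1) * m) ≤ |t| * (|t| - m) := by
    refine mul_le_mul hk (by linarith) (mul_nonneg (by linarith) hm) (abs_nonneg t)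
  have h5 : (d - 1 : ℝ) * (m ^ 2 / 4) ≤ (d * m) * ((d - 1) * m) := by
    have : 0 ≤ (d - 1 : ℝ) * m ^ 2 := mul_nonneg (by linarith) (sq_nonneg m)
    nlinarith
  have h6 := mul_le_mul_of_nonneg_left (h5.trans h4) ha
  nlinarith

variable {N : ℕ} {ω : Env d} {h : Lattice d → ℝ}

/-- Two slopes at the same contact point are close. -/
lemma abs_slope_sub_le [Nonempty (Fin d)] (hN : 0 < N) (hω : IsBalanced ω)
    (hg : ∀ n x, ∑ i, green (periodized ω N) i n x ≤ h x) (u : Lattice d → ℝ) {a : ℝ} (ha : 0 ≤ a)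
    {x₀ z : Lattice d} {s s' : Fin d → ℝ}
    (hs : ∀ x, u (fold N x) - tiltedParaboloid a x₀ s x ≤
      u (fold N z) - tiltedParaboloid a x₀ s z)
    (hs' : ∀ x, u (fold N x) - tiltedParaboloid a x₀ s' x ≤
      u (fold N z) - tiltedParaboloid a x₀ s' z) (j : Fin d) :
    |s j - s' j| ≤ 2 * (u (fold N z) - foldedOp ω N u z + a * h z) := by
  have hη := hω.periodized N
  set η := periodized ω N with hηd
  have hquad : ∀ (s : Fin d → ℝ) (n : ℕ), stoppedExp η
      (fun x _ => tiltedParaboloid a x₀ s x) n z Finset.univ ≤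
      tiltedParaboloid a x₀ s z + a * h z := by
    intro s n
    rw [stoppedExp_quadratic hη (a := a) fun x j => by
      rw [tiltedParaboloid_add_vec, tiltedParaboloid_add_vec]; push_cast; ring]
    exact add_le_add le_rfl (mul_le_mul_of_nonneg_left ((sum_unfinished_le η n z).trans (hg n z)) ha)
  have hlin : ∀ n, |s j - s' j| * stoppedExp η (fun _ S => if j ∈ S then 0 else 1) n z
      Finset.univ ≤ 2 * (u (fold N z) -
        stoppedExp η (fun x _ => u (fold N x)) n z Finset.univ + a * h z) := by
    intro n
    refine (le_stoppedExp_abs hη (F := tiltedParaboloid 0 z fun j => s j - s' j)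
      (r := fun j => s j - s' j)
      (fun x j => by rw [tiltedParaboloid_add_vec]; push_cast; ring)
      (fun x j => by rw [tiltedParaboloid_add_vec]; push_cast; ring) j n z
      (Finset.mem_univ j)).trans ?_
    -- Both touching paraboloids leave nonnegative gaps above `u`. The linear function is the
    -- difference of the gaps, so its absolute value is at most their sum.
    have h1 : ∀ (x : Lattice d), |tiltedParaboloid 0 z (fun j => s j - s' j) x| ≤
        2 * (u (fold N z) - u (fold N x)) + ((tiltedParaboloid a x₀ s x -
          tiltedParaboloid a x₀ s z) +
          (tiltedParaboloid a x₀ s' x - tiltedParaboloid a x₀ s' z)) := by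
      intro x
      rw [← tiltedParaboloid_sub a x₀ s s' x z, abs_le]
      constructor <;> linarith [hs x, hs' x]
    refine (stoppedExp_mono η (fun x _ => h1 x) n z _).trans ?_
    rw [stoppedExp_add, stoppedExp_const_mul, stoppedExp_sub, stoppedExp_const, stoppedExp_add,
      stoppedExp_sub, stoppedExp_const, stoppedExp_sub, stoppedExp_const]
    linarith [hquad s n, hquad s' n]
  -- Coordinate `j` eventually moves with probability one, so the full coefficient survives in the
  -- limit.
  have hone : Tendsto (fun n => stoppedExp η (fun _ S => if j ∈ S then 0 else 1) n z Finset.univ)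
      atTop (nhds 1) := by
    have h1 := (tendsto_survival hg j z).const_sub 1
    rw [sub_zero] at h1
    refine h1.congr fun n => ?_
    have h2 := stoppedExp_mem η j n z Finset.univ
    rw [if_pos (Finset.mem_univ j)] at h2
    rw [← h2]
    nth_rw 1 [← stoppedExp_const η 1 n z Finset.univ]
    rw [← stoppedExp_sub]
    congr 1
    funext x S
    split_ifs <;> simp
  have hl := hone.const_mul |s j - s' j|
  rw [mul_one] at hl
  exact le_of_tendsto_of_tendsto' hl ((((tendsto_stoppedExp_fold hN hg u z).const_sub
    (u (fold N z))).add_const (a * h z)).const_mul 2) hlin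

/-- The interval meets at most `d + 1` periods of length `2 * N`, each with at most two preimages of
a value. -/
lemma card_foldInt_fiber_le (hN : 0 < N) (b y : ℤ) :
    ((Finset.Icc (b - d * N) (b + d * N)).filter fun t => foldInt N t = y).card ≤
      2 * (d + 1) := by
  have hm : (0 : ℤ) < 2 * N := by lia
  set q := (b - d * N) / (2 * N : ℤ) with hq
  have hsub : ((Finset.Icc (b - d * N) (b + d * N)).filter fun t => foldInt N t = y) ⊆
      (Finset.Icc q (q + d)).image (fun k => 2 * N * k + y) ∪
      (Finset.Icc q (q + d)).image (fun k => 2 * N * k + (2 * N - 1 - y)) := by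
    intro t ht
    rw [Finset.mem_filter, Finset.mem_Icc] at ht
    obtain ⟨⟨h1, h2⟩, h3⟩ := ht
    have hmem : t / (2 * N : ℤ) ∈ Finset.Icc q (q + d) := by
      rw [Finset.mem_Icc]
      refine ⟨Int.ediv_le_ediv hm h1, ?_⟩
      have h4 : b + d * N = (b - d * N) + d * (2 * N) := by ring
      have h5 := Int.ediv_le_ediv hm h2
      rw [h4, Int.add_mul_ediv_right _ _ hm.ne'] at h5
      exact h5
    have h6 := Int.mul_ediv_add_emod t (2 * N)
    rw [Finset.mem_union, Finset.mem_image, Finset.mem_image]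
    unfold foldInt at h3
    rcases min_choice (t % (2 * N : ℤ)) (2 * N - 1 - t % (2 * N : ℤ)) with h7 | h7
    · left
      exact ⟨_, hmem, by rw [← h3, h7, h6]⟩
    · right
      refine ⟨_, hmem, ?_⟩
      rw [← h3, h7]
      linarith
  refine (Finset.card_le_card hsub).trans ((Finset.card_union_le _ _).trans ?_)
  have h1 := Finset.card_image_le (s := Finset.Icc q (q + d)) (f := fun k => 2 * N * k + y)
  have h2 := Finset.card_image_le (s := Finset.Icc q (q + d))
    (f := fun k => 2 * N * k + (2 * N - 1 - y))
  rw [Int.card_Icc] at h1 h2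
  lia

/-- The lattice points at distance at most `d N` from `x₀`. -/
noncomputable def bigBox (N : ℕ) (x₀ : Lattice d) : Finset (Lattice d) :=
  Fintype.piFinset fun j => Finset.Icc (x₀ j - d * N) (x₀ j + d * N)

lemma sum_bigBox_fold_le (hN : 0 < N) (x₀ : Lattice d) {G : Lattice d → ℝ}
    (hG : ∀ y ∈ cube d N, 0 ≤ G y) :
    ∑ z ∈ bigBox N x₀, G (fold N z) ≤ (2 * (d + 1) : ℝ) ^ d * ∑ y ∈ cube d N, G y := by
  rw [← Finset.sum_fiberwise_of_maps_to (g := fold N) fun z _ => fold_mem_cube hN z,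
    Finset.mul_sum]
  refine Finset.sum_le_sum fun y hy => ?_
  rw [Finset.sum_congr rfl fun z hz => by rw [(Finset.mem_filter.1 hz).2], Finset.sum_const,
    nsmul_eq_mul]
  refine mul_le_mul_of_nonneg_right ?_ (hG y hy)
  have hsub : (bigBox N x₀).filter (fun z => fold N z = y) ⊆ Fintype.piFinset fun j =>
      (Finset.Icc (x₀ j - d * N) (x₀ j + d * N)).filter fun t => foldInt N t = y j := by
    intro z hz
    rw [Finset.mem_filter, bigBox, Fintype.mem_piFinset] at hz
    rw [Fintype.mem_piFinset]
    exact fun j => Finset.mem_filter.2 ⟨hz.1 j, by rw [← fold_apply, hz.2]⟩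
  have h1 := Finset.card_le_card hsub
  rw [Fintype.card_piFinset] at h1
  have h2 := Finset.prod_le_prod' fun (j : Fin d) (_ : j ∈ Finset.univ) =>
    card_foldInt_fiber_le (d := d) hN (x₀ j) (y j)
  rw [Finset.prod_const, Finset.card_univ, Fintype.card_fin] at h2
  exact_mod_cast h1.trans h2

/-- Covering of a cube of slopes by the slopes of contact points. -/
lemma pow_le_sum_contact [Nonempty (Fin d)] (hN : 0 < N) (hω : IsBalanced ω)
    (hg : ∀ n x, ∑ i, green (periodized ω N) i n x ≤ h x) {u : Lattice d → ℝ} {x₀ : Lattice d}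
    (hx₀ : x₀ ∈ cube d N) (hmax : ∀ y ∈ cube d N, u y ≤ u x₀) {a : ℝ} (ha : 0 < a)
    {b : Lattice d → ℝ}
    (hb : ∀ z, u x₀ - d * (a * N ^ 2 / 4) ≤ u (fold N z) →
      u (fold N z) - foldedOp ω N u z + a * h z ≤ b z) (hb0 : ∀ z, 0 ≤ b z) :
    (2 * (a * N)) ^ d ≤ ∑ z ∈ bigBox N x₀, (4 * b z) ^ d := by
  classical
  set F : (Fin d → ℝ) → Lattice d → ℝ := fun s x => u (fold N x) - tiltedParaboloid a x₀ s x with hF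
  set C : Lattice d → Set (Fin d → ℝ) := fun z =>
    {s | (∀ j, |s j| ≤ a * N) ∧ ∀ x, F s x ≤ F s z} with hC
  have hF0 : ∀ s, F s x₀ = u x₀ := fun s => by
    simp only [hF, tiltedParaboloid_self, fold_of_mem hx₀, sub_zero]
  have hle : ∀ x, u (fold N x) ≤ u x₀ := fun x => hmax _ (fold_mem_cube hN x)
  have hcover : Metric.closedBall (0 : Fin d → ℝ) (a * N) ⊆ ⋃ z ∈ bigBox N x₀, C z := by
    intro s hs
    have hs' : ∀ j, |s j| ≤ a * N := by
      rw [mem_closedBall_zero_iff, pi_norm_le_iff_of_nonneg (by positivity)] at hs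
      exact hs
    have hx₀B : x₀ ∈ bigBox N x₀ := by
      rw [bigBox, Fintype.mem_piFinset]
      intro j
      have : (0 : ℤ) ≤ d * N := by positivity
      rw [Finset.mem_Icc]
      lia
    obtain ⟨z, hzB, hz⟩ := Finset.exists_max_image (bigBox N x₀) (F s) ⟨x₀, hx₀B⟩
    refine Set.mem_iUnion₂.2 ⟨z, hzB, hs', fun x => ?_⟩
    by_cases hx : x ∈ bigBox N x₀
    · exact hz x hx
    -- Outside the big box the paraboloid is nonnegative, so `F s` there is at most `u x₀ = F s x₀`,
    -- and the maximum over the finite box is global.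
    · refine le_trans ?_ (hz x₀ hx₀B)
      rw [hF0]
      rw [bigBox, Fintype.mem_piFinset] at hx
      push Not at hx
      obtain ⟨k, hk⟩ := hx
      rw [Finset.mem_Icc] at hk
      have hk' : (d * N : ℤ) ≤ |x k - x₀ k| := by
        rw [le_abs]
        lia
      have := tiltedParaboloid_nonneg_of_far ha.le (Nat.cast_nonneg N) hs' (x₀ := x₀) (x := x)
        (k := k) (by exact_mod_cast hk')
      simp only [hF]
      linarith [hle x]
  have hvol : ∀ z, volume (C z) ≤ ENNReal.ofReal ((4 * b z) ^ d) := by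
    intro z
    rcases (C z).eq_empty_or_nonempty with h0 | ⟨s', hs'⟩
    · rw [h0, measure_empty]
      exact zero_le
    -- Since `x₀` competes for the maximum, `u` at a contact point falls short of `u x₀` by at most
    -- the depth of the paraboloid.
    · have h1 : u x₀ - d * (a * N ^ 2 / 4) ≤ u (fold N z) := by
        have h2 := hs'.2 x₀
        have h3 := neg_le_tiltedParaboloid ha.le hs'.1 x₀ z
        rw [hF0] at h2
        simp only [hF] at h2
        linarith
      have hsub : C z ⊆ Metric.closedBall s' (2 * b z) := by
        intro s hs
        rw [mem_closedBall_iff_norm, pi_norm_le_iff_of_nonneg (by linarith [hb0 z])]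
        intro j
        exact (abs_slope_sub_le hN hω hg u ha.le hs.2 hs'.2 j).trans (by linarith [hb z h1])
      refine (measure_mono hsub).trans_eq ?_
      rw [Real.volume_pi_closedBall _ (by linarith [hb0 z]), Fintype.card_fin]
      congr 2
      ring
  have h1 : ENNReal.ofReal ((2 * (a * N)) ^ d) ≤
      ENNReal.ofReal (∑ z ∈ bigBox N x₀, (4 * b z) ^ d) := by
    have h2 := (measure_mono hcover).trans (measure_biUnion_finset_le (μ := volume)
      (bigBox N x₀) C)
    rw [Real.volume_pi_closedBall _ (by positivity), Fintype.card_fin] at h2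
    rw [ENNReal.ofReal_sum_of_nonneg fun z _ => pow_nonneg (by linarith [hb0 z]) d]
    exact h2.trans (Finset.sum_le_sum fun z _ => hvol z)
  exact (ENNReal.ofReal_le_ofReal_iff (Finset.sum_nonneg fun z _ =>
    pow_nonneg (by linarith [hb0 z]) d)).1 h1

end

/-! ### Finite stochastic matrices -/

section

variable {ι : Type*} [Fintype ι]

/-- Constants are right eigenvectors, so a left eigenvector `v` with eigenvalue one exists. Then
`|v| ≤ |v| P` with equal totals forces equality, and `|v|` can be normalised; irreducibility plays
no role. -/
lemma exists_stationary_vector [Nonempty ι] {P : ι → ι → ℝ}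
    (hP0 : ∀ x y, 0 ≤ P x y) (hP1 : ∀ x, ∑ y, P x y = 1) :
    ∃ p : ι → ℝ, (∀ x, 0 ≤ p x) ∧ ∑ x, p x = 1 ∧ ∀ y, ∑ x, p x * P x y = p y := by
  classical
  have hdet : (Matrix.of P - 1).det = 0 := by
    refine Matrix.exists_mulVec_eq_zero_iff.1 ⟨fun _ => 1, ?_, ?_⟩
    · intro h
      have := congrFun h (Classical.arbitrary ι)
      simp at this
    · rw [Matrix.sub_mulVec, Matrix.one_mulVec]
      funext x
      simp [Matrix.mulVec, dotProduct, hP1]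
  obtain ⟨v, hv0, hv⟩ := Matrix.exists_vecMul_eq_zero_iff.2 hdet
  have hv' : ∀ y, ∑ x, v x * P x y = v y := by
    intro y
    have := congrFun hv y
    rw [Matrix.vecMul_sub, Matrix.vecMul_one] at this
    simp only [Pi.sub_apply, Pi.zero_apply, Matrix.vecMul, dotProduct, Matrix.of_apply] at this
    linarith
  have hle : ∀ y, |v y| ≤ ∑ x, |v x| * P x y := by
    intro y
    conv_lhs => rw [← hv' y]
    refine (Finset.abs_sum_le_sum_abs _ _).trans_eq (Finset.sum_congr rfl fun x _ => ?_)
    rw [abs_mul, abs_of_nonneg (hP0 x y)]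
  have htot : ∑ y, ∑ x, |v x| * P x y = ∑ y, |v y| := by
    rw [Finset.sum_comm]
    simp only [← Finset.mul_sum, hP1, mul_one]
  have heq : ∀ y, |v y| = ∑ x, |v x| * P x y := fun y =>
    (Finset.sum_eq_sum_iff_of_le fun y _ => hle y).1 htot.symm y (Finset.mem_univ y)
  have hpos : 0 < ∑ x, |v x| := by
    obtain ⟨x, hx⟩ := Function.ne_iff.1 hv0
    exact Finset.sum_pos' (fun _ _ => abs_nonneg _) ⟨x, Finset.mem_univ x, abs_pos.2 hx⟩
  refine ⟨fun x => |v x| / ∑ x, |v x|, fun x => by positivity, ?_, fun y => ?_⟩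
  · rw [← Finset.sum_div, div_self hpos.ne']
  · beta_reduce
    rw [heq y, Finset.sum_div]
    exact Finset.sum_congr rfl fun x _ => by ring

/-- `l P` contracts the supremum norm, so `id - l P` is injective and, in finite dimension,
surjective. -/
lemma exists_resolvent {P : ι → ι → ℝ} (hP0 : ∀ x y, 0 ≤ P x y) (hP1 : ∀ x, ∑ y, P x y = 1)
    {l : ℝ} (hl0 : 0 ≤ l) (hl1 : l < 1) (g : ι → ℝ) :
    ∃ u : ι → ℝ, ∀ x, u x = g x + l * ∑ y, P x y * u y := by
  classical
  set L : (ι → ℝ) →ₗ[ℝ] (ι → ℝ) := LinearMap.id - l • Matrix.toLin' (Matrix.of P) with hL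
  have happ : ∀ u x, L u x = u x - l * ∑ y, P x y * u y := fun u x => by
    simp [hL, Matrix.toLin'_apply, Matrix.mulVec, dotProduct]
  have hinj : Function.Injective L := by
    rw [injective_iff_map_eq_zero]
    intro v hv
    have h1 : ∀ x, |v x| ≤ l * ‖v‖ := by
      intro x
      have h2 := congrFun hv x
      rw [happ, Pi.zero_apply, sub_eq_zero] at h2
      rw [h2, abs_mul, abs_of_nonneg hl0]
      refine mul_le_mul_of_nonneg_left ((Finset.abs_sum_le_sum_abs _ _).trans ?_) hl0
      refine (Finset.sum_le_sum fun y _ => ?_).trans_eq (b := ∑ y, P x y * ‖v‖) ?_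
      · rw [abs_mul, abs_of_nonneg (hP0 x y)]
        exact mul_le_mul_of_nonneg_left (norm_le_pi_norm v y) (hP0 x y)
      · rw [← Finset.sum_mul, hP1, one_mul]
    have h3 : ‖v‖ ≤ l * ‖v‖ :=
      (pi_norm_le_iff_of_nonneg (mul_nonneg hl0 (norm_nonneg v))).2 h1
    have h4 : ‖v‖ = 0 := le_antisymm (by nlinarith [norm_nonneg v]) (norm_nonneg v)
    exact norm_eq_zero.1 h4
  obtain ⟨u, hu⟩ := LinearMap.surjective_of_injective hinj g
  refine ⟨u, fun x => ?_⟩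
  have h := happ u x
  rw [hu] at h
  linarith

end

/-! ### The bound for stationary measures -/

section

variable {d N : ℕ} {ω : Env d} {h : Lattice d → ℝ}

/-- A small constant used for the paraboloid in the maximum principle. -/
noncomputable def opening (d : ℕ) (A : ℝ) : ℝ :=
  min (2 / d) (1 / (8 ^ d * (2 * (d + 1)) ^ d * (2 * A)))

/-- The constant of the maximum principle. -/
noncomputable def maxConst (d : ℕ) (A : ℝ) : ℝ := 16 ^ d * (2 * (d + 1)) ^ d / opening d A ^ d

lemma opening_pos [Nonempty (Fin d)] {A : ℝ} (hA : 0 < A) : 0 < opening d A := by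
  have hd : 0 < d := (Classical.arbitrary (Fin d)).pos
  unfold opening
  positivity

lemma maxConst_pos [Nonempty (Fin d)] {A : ℝ} (hA : 0 < A) : 0 < maxConst d A := by
  have := opening_pos (d := d) hA
  unfold maxConst
  positivity

/-- Slope covering with opening `a = θ u(x₀) / N²`. The error `a h` is split at a level `t`: below
it the killing of the resolvent absorbs the error, above it the moment of order `d + 1` makes it a
small fraction of the slope volume. The rest of that volume is paid by `g`. -/
lemma max_resolvent_pow_le [Nonempty (Fin d)] (hN : 2 ≤ N) (hω : IsBalanced ω)
    (hfold : ∀ x, h x = h (fold N x))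
    (hg : ∀ n x, ∑ i, green (periodized ω N) i n x ≤ h x) {A : ℝ} (hA : 0 < A)
    (hsum : ∑ c ∈ cube d N, h c ^ (d + 1) ≤ A * (N : ℝ) ^ d) {u g : Lattice d → ℝ}
    (hg0 : ∀ y ∈ cube d N, 0 ≤ g y)
    (hu : ∀ y ∈ cube d N, u y = g y + (1 - 1 / (N : ℝ) ^ 2) * foldedOp ω N u y)
    {x₀ : Lattice d} (hx₀ : x₀ ∈ cube d N) (hmax : ∀ y ∈ cube d N, u y ≤ u x₀)
    (hpos : 0 < u x₀) :
    u x₀ ^ d ≤ maxConst d A * (N : ℝ) ^ d * ∑ y ∈ cube d N, g y ^ d := by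
  have hd : 0 < d := (Classical.arbitrary (Fin d)).pos
  have hN0 : 0 < N := by lia
  have hNr : (2 : ℝ) ≤ N := by exact_mod_cast hN
  have hθ := opening_pos (d := d) hA
  set θ := opening d A with hθd
  have hθ1 : d * θ ≤ 2 := by
    have h1 : θ ≤ 2 / d := min_le_left _ _
    rw [le_div_iff₀ (by positivity)] at h1
    linarith
  set κ : ℝ := (2 * (d + 1) : ℝ) ^ d with hκ
  have hκ0 : 0 < κ := by positivity
  have hθ2 : θ * (8 ^ d * κ * (2 * A)) ≤ 1 := by
    have h1 : θ ≤ 1 / (8 ^ d * κ * (2 * A)) := min_le_right _ _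
    rwa [le_div_iff₀ (by positivity)] at h1
  have hh0 : ∀ x, 0 ≤ h x := fun x => le_trans (by simp [green]) (hg 0 x)
  set a : ℝ := θ * u x₀ / (N : ℝ) ^ 2 with ha
  have ha0 : 0 < a := by positivity
  have haN : a * (N : ℝ) ^ 2 = θ * u x₀ := by rw [ha]; field_simp
  -- Then `a * t = u x₀ / (2 N²)`, which the killing supplies at contact points, where `u ≥ u x₀ /
  -- 2`.
  set t : ℝ := 1 / (2 * θ) with ht
  have ht0 : 0 < t := by positivity
  have hcontact := pow_le_sum_contact hN0 hω hg hx₀ hmax ha0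
    (b := fun z => 2 * g (fold N z) + a * max (h z - t) 0) (fun z hz => by
      have h1 : u x₀ / 2 ≤ u (fold N z) := by
        refine le_trans ?_ hz
        rw [haN]
        nlinarith
      have h2 := hu _ (fold_mem_cube hN0 z)
      rw [← foldedOp_fold hN0 hω hg u z] at h2
      have h3 := hg0 _ (fold_mem_cube hN0 z)
      set ε : ℝ := 1 / (N : ℝ) ^ 2 with hε
      have hε0 : 0 < ε := by positivity
      have hε1 : ε ≤ 1 / 4 := by
        rw [hε]
        exact one_div_le_one_div_of_le (by norm_num) (by nlinarith)
      have h4 : a * t = ε * (u x₀ / 2) := by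
        rw [ha, ht, hε]
        field_simp
      have h5 : a * (h z - t) ≤ a * max (h z - t) 0 :=
        mul_le_mul_of_nonneg_left (le_max_left _ _) ha0.le
      -- The equation says `(1 - ε) (u - P u) = g - ε u`; as `ε ≤ 1/4`, dividing by `1 - ε` costs at
      -- most the factor two on `g`.
      have h6 : u (fold N z) - foldedOp ω N u z ≤ 2 * g (fold N z) - ε * u (fold N z) := by
        have h7 : (1 - ε) * (u (fold N z) - foldedOp ω N u z) =
            g (fold N z) - ε * u (fold N z) := by linarith
        have h8 : 0 ≤ u (fold N z) := by linarith
        have h9 : (1 - ε) * (2 * g (fold N z) - ε * u (fold N z)) ≥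
            g (fold N z) - ε * u (fold N z) := by
          nlinarith [mul_nonneg (mul_nonneg hε0.le hε0.le) h8, mul_nonneg h3 (sub_nonneg.2 hε1)]
        by_contra hc
        push Not at hc
        have := mul_lt_mul_of_pos_left hc (show 0 < 1 - ε by linarith)
        linarith
      have h10 : ε * (u x₀ / 2) ≤ ε * u (fold N z) := mul_le_mul_of_nonneg_left h1 hε0.le
      linarith)
    (fun z => add_nonneg (mul_nonneg zero_le_two (hg0 _ (fold_mem_cube hN0 z)))
      (mul_nonneg ha0.le (le_max_right _ _)))
  set G : Lattice d → ℝ := fun y => 8 ^ d * (2 ^ d * g y ^ d + a ^ d * (2 * θ * h y ^ (d + 1)))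
    with hG
  have hG0 : ∀ y ∈ cube d N, 0 ≤ G y := fun y hy => by
    have := hg0 y hy
    have := hh0 y
    positivity
  have hterm : ∀ z, (4 * (2 * g (fold N z) + a * max (h z - t) 0)) ^ d ≤ G (fold N z) := by
    intro z
    have h1 := hg0 _ (fold_mem_cube hN0 z)
    have h2 : 0 ≤ a * max (h z - t) 0 := mul_nonneg ha0.le (le_max_right _ _)
    -- Above the level `t` one has `2 θ h ≥ 1`: one extra power of `h` is traded for the small
    -- factor `θ`.
    have h3 : max (h z - t) 0 ^ d ≤ 2 * θ * h (fold N z) ^ (d + 1) := by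
      rw [← hfold z]
      have h4 := hh0 z
      rcases le_total (h z - t) 0 with h5 | h5
      · rw [max_eq_right h5, zero_pow hd.ne']
        positivity
      · rw [max_eq_left h5]
        refine (pow_le_pow_left₀ h5 (by linarith : h z - t ≤ h z) d).trans ?_
        have h6 : 1 ≤ 2 * θ * h z := by
          have : 2 * θ * t = 1 := by rw [ht]; field_simp
          nlinarith
        have h7 := mul_le_mul_of_nonneg_left h6 (pow_nonneg h4 d)
        calc h z ^ d = h z ^ d * 1 := (mul_one _).symm
          _ ≤ h z ^ d * (2 * θ * h z) := h7
          _ = 2 * θ * h z ^ (d + 1) := by ring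
    calc (4 * (2 * g (fold N z) + a * max (h z - t) 0)) ^ d
        = 4 ^ d * (2 * g (fold N z) + a * max (h z - t) 0) ^ d := mul_pow _ _ _
      _ ≤ 4 ^ d * (2 ^ (d - 1) * ((2 * g (fold N z)) ^ d + (a * max (h z - t) 0) ^ d)) :=
          mul_le_mul_of_nonneg_left (add_pow_le (by linarith) h2 d) (by positivity)
      _ ≤ 4 ^ d * (2 ^ d * ((2 * g (fold N z)) ^ d + (a * max (h z - t) 0) ^ d)) := by
          gcongr
          · norm_num
          · lia
      _ = 8 ^ d * (2 ^ d * g (fold N z) ^ d + a ^ d * max (h z - t) 0 ^ d) := by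
          have h8 : (8 : ℝ) ^ d = 4 ^ d * 2 ^ d := by rw [← mul_pow]; norm_num
          rw [h8, mul_pow, mul_pow]
          ring
      _ ≤ G (fold N z) := by
          simp only [hG]
          gcongr
  have htotal := hcontact.trans ((Finset.sum_le_sum fun z _ => hterm z).trans
    (sum_bigBox_fold_le hN0 x₀ hG0))
  have hGsum : ∑ y ∈ cube d N, G y = 8 ^ d * (2 ^ d * ∑ y ∈ cube d N, g y ^ d +
      a ^ d * (2 * θ * ∑ y ∈ cube d N, h y ^ (d + 1))) := by
    simp only [hG, ← Finset.mul_sum, Finset.sum_add_distrib]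
  rw [hGsum, ← hκ] at htotal
  set ρ : ℝ := a * N with hρ
  have hρ0 : 0 < ρ := by positivity
  -- The second entry of the minimum in `opening` is chosen for this: the errors use at most `ρ ^
  -- d`, while `(2 ρ) ^ d ≥ 2 ρ ^ d` is available.
  have hsmall : κ * (8 ^ d * (a ^ d * (2 * θ * ∑ y ∈ cube d N, h y ^ (d + 1)))) ≤ ρ ^ d := by
    calc κ * (8 ^ d * (a ^ d * (2 * θ * ∑ y ∈ cube d N, h y ^ (d + 1))))
        ≤ κ * (8 ^ d * (a ^ d * (2 * θ * (A * (N : ℝ) ^ d)))) := by gcongr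
      _ = θ * (8 ^ d * κ * (2 * A)) * (a ^ d * (N : ℝ) ^ d) := by ring
      _ ≤ 1 * (a ^ d * (N : ℝ) ^ d) := by gcongr
      _ = ρ ^ d := by rw [one_mul, hρ, mul_pow]
  have h2ρ : 2 * ρ ^ d ≤ (2 * ρ) ^ d := by
    rw [mul_pow 2 ρ d]
    exact mul_le_mul_of_nonneg_right (le_self_pow₀ one_le_two hd.ne') (pow_nonneg hρ0.le d)
  have hmain : ρ ^ d ≤ 16 ^ d * κ * ∑ y ∈ cube d N, g y ^ d := by
    have h16 : (16 : ℝ) ^ d = 8 ^ d * 2 ^ d := by rw [← mul_pow]; norm_num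
    rw [h16]
    linarith
  have hρM : ρ ^ d = θ ^ d * u x₀ ^ d / (N : ℝ) ^ d := by
    rw [← mul_pow, ← div_pow]
    congr 1
    rw [hρ, ha]
    field_simp
  rw [hρM, div_le_iff₀ (by positivity)] at hmain
  rw [maxConst, ← hκ, ← hθd, div_mul_eq_mul_div, div_mul_eq_mul_div, le_div_iff₀ (by positivity)]
  linarith

/-- Integrals against stationary measures are controlled by the `L^d` norm. -/
lemma stationary_sum_pow_le [Nonempty (Fin d)] (hN : 2 ≤ N) (hω : IsBalanced ω)
    (hfold : ∀ x, h x = h (fold N x))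
    (hg : ∀ n x, ∑ i, green (periodized ω N) i n x ≤ h x) {A : ℝ} (hA : 0 < A)
    (hsum : ∑ c ∈ cube d N, h c ^ (d + 1) ≤ A * (N : ℝ) ^ d) {p : Lattice d → ℝ}
    (hp0 : ∀ y, 0 ≤ p y) (hp1 : ∑ y ∈ cube d N, p y = 1)
    (hp : ∀ y ∈ cube d N, ∑ x ∈ cube d N, p x * (foldedTransition ω N x y).toReal = p y)
    {g : Lattice d → ℝ} (hg0 : ∀ y ∈ cube d N, 0 ≤ g y) :
    ((N : ℝ) ^ 2 * ∑ y ∈ cube d N, p y * g y) ^ d ≤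
      maxConst d A * (N : ℝ) ^ d * ∑ y ∈ cube d N, g y ^ d := by
  have hd : 0 < d := (Classical.arbitrary (Fin d)).pos
  have hN0 : 0 < N := by lia
  have hNr : (2 : ℝ) ≤ N := by exact_mod_cast hN
  have hN2 : (0 : ℝ) < (N : ℝ) ^ 2 := by positivity
  have hl0 : 0 ≤ 1 - 1 / (N : ℝ) ^ 2 := by
    rw [sub_nonneg, div_le_one hN2]
    nlinarith
  obtain ⟨v, hv⟩ := exists_resolvent (ι := cube d N)
    (P := fun x y => (foldedTransition ω N x y).toReal) (fun _ _ => ENNReal.toReal_nonneg)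
    (fun x => by
      rw [Finset.sum_coe_sort (cube d N) fun y => (foldedTransition ω N x y).toReal]
      exact foldedOp_one hN0 hg x) hl0 (sub_lt_self _ (by positivity)) (fun x => g x)
  classical
  set u : Lattice d → ℝ := fun y => if hy : y ∈ cube d N then v ⟨y, hy⟩ else 0 with hu
  have huv : ∀ y : cube d N, u y = v y := fun y => by simp [hu]
  have heq : ∀ y ∈ cube d N, u y = g y + (1 - 1 / (N : ℝ) ^ 2) * foldedOp ω N u y := by
    intro y hy
    have h1 := hv ⟨y, hy⟩
    simp only [← huv] at h1
    rw [Finset.sum_coe_sort (cube d N) fun z => (foldedTransition ω N y z).toReal * u z] at h1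
    exact h1
  obtain ⟨x₀, hx₀, hmax⟩ := Finset.exists_max_image (cube d N) u ⟨_, fold_mem_cube hN0 0⟩
  have hpu : ∑ y ∈ cube d N, p y * foldedOp ω N u y = ∑ y ∈ cube d N, p y * u y := by
    simp only [foldedOp, Finset.mul_sum]
    rw [Finset.sum_comm]
    refine Finset.sum_congr rfl fun y hy => ?_
    rw [← hp y hy, Finset.sum_mul]
    exact Finset.sum_congr rfl fun x _ => by ring
  have h1 : ∑ y ∈ cube d N, p y * u y = ∑ y ∈ cube d N, p y * g y +
      (1 - 1 / (N : ℝ) ^ 2) * ∑ y ∈ cube d N, p y * u y := by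
    conv_lhs => rw [Finset.sum_congr rfl fun y hy => by rw [heq y hy]]
    conv_rhs => rw [← hpu]
    rw [Finset.mul_sum, ← Finset.sum_add_distrib]
    exact Finset.sum_congr rfl fun y _ => by ring
  -- Stationarity replaces `P u` by `u` under the sum, leaving only the defect `1 / N ^ 2`.
  have h2 : (N : ℝ) ^ 2 * ∑ y ∈ cube d N, p y * g y = ∑ y ∈ cube d N, p y * u y := by
    field_simp at h1
    linarith
  have h3 : ∑ y ∈ cube d N, p y * u y ≤ u x₀ := by
    refine (Finset.sum_le_sum fun y hy =>
      mul_le_mul_of_nonneg_left (hmax y hy) (hp0 y)).trans_eq ?_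
    rw [← Finset.sum_mul, hp1, one_mul]
  have h4 : 0 ≤ ∑ y ∈ cube d N, p y * g y :=
    Finset.sum_nonneg fun y hy => mul_nonneg (hp0 y) (hg0 y hy)
  rcases le_or_gt (u x₀) 0 with h5 | h5
  · have h6 : (N : ℝ) ^ 2 * ∑ y ∈ cube d N, p y * g y = 0 :=
      le_antisymm (by linarith) (by positivity)
    rw [h6, zero_pow hd.ne']
    have := maxConst_pos (d := d) hA
    have : 0 ≤ ∑ y ∈ cube d N, g y ^ d := Finset.sum_nonneg fun y hy => pow_nonneg (hg0 y hy) d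
    positivity
  · rw [h2]
    refine (pow_le_pow_left₀ (by rw [← h2]; positivity) h3 d).trans ?_
    exact max_resolvent_pow_le hN hω hfold hg hA hsum hg0 heq hx₀ hmax h5

end

/-! ### Stationary measures and their densities -/

section

variable {d N : ℕ} {ω : Env d} {h : Lattice d → ℝ}

lemma foldedTransition_ne_top (ω : Env d) (N : ℕ) (x y : Lattice d) :
    foldedTransition ω N x y ≠ ⊤ := measure_ne_top _ _

lemma exists_isStationary [Nonempty (Fin d)] (hN : 0 < N)
    (hg : ∀ n x, ∑ i, green (periodized ω N) i n x ≤ h x) :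
    ∃ H : Measure (Lattice d), IsStationary ω N H := by
  have hne : Nonempty (cube d N) := ⟨⟨_, fold_mem_cube hN 0⟩⟩
  obtain ⟨p, hp0, hp1, hp⟩ := exists_stationary_vector (ι := cube d N)
    (P := fun x y => (foldedTransition ω N x y).toReal) (fun _ _ => ENNReal.toReal_nonneg)
    (fun x => by
      rw [Finset.sum_coe_sort (cube d N) fun y => (foldedTransition ω N x y).toReal]
      exact foldedOp_one hN hg x)
  set H : Measure (Lattice d) :=
    ∑ x : cube d N, ENNReal.ofReal (p x) • Measure.dirac (x : Lattice d) with hH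
  have hsing : ∀ y : cube d N, H {(y : Lattice d)} = ENNReal.ofReal (p y) := by
    intro y
    simp only [hH, Measure.coe_finsetSum, Finset.sum_apply, Measure.smul_apply, smul_eq_mul]
    rw [Finset.sum_eq_single y]
    · simp
    · intro x _ hxy
      rw [Measure.dirac_apply' _ (measurableSet_singleton _), Set.indicator_of_notMem, mul_zero]
      exact fun hx => hxy (Subtype.ext hx)
    · simp
  refine ⟨H, ⟨⟨?_⟩, ?_, fun y hy => ?_⟩⟩
  · simp only [hH, Measure.coe_finsetSum, Finset.sum_apply, Measure.smul_apply, smul_eq_mul,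
      measure_univ, mul_one]
    rw [← ENNReal.ofReal_sum_of_nonneg fun x _ => hp0 x, hp1, ENNReal.ofReal_one]
  · simp only [hH, Measure.coe_finsetSum, Finset.sum_apply, Measure.smul_apply, smul_eq_mul]
    refine Finset.sum_eq_zero fun x _ => ?_
    rw [Measure.dirac_apply, Set.indicator_of_notMem, mul_zero]
    simp
  · rw [hsing ⟨y, hy⟩, ← hp ⟨y, hy⟩, ENNReal.ofReal_sum_of_nonneg fun x _ =>
      mul_nonneg (hp0 x) ENNReal.toReal_nonneg,
      ← Finset.sum_coe_sort (cube d N) fun x => H {x} * foldedTransition ω N x y]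
    refine Finset.sum_congr rfl fun x _ => ?_
    rw [hsing x, ENNReal.ofReal_mul (hp0 x), ENNReal.ofReal_toReal (foldedTransition_ne_top ω N _ _)]

lemma uniformCube_singleton {y : Lattice d} (hy : y ∈ cube d N) :
    uniformCube d N {y} = ENNReal.ofReal (1 / (N : ℝ) ^ d) := by
  have hc : 0 < (cube d N).card := Finset.card_pos.2 ⟨y, hy⟩
  have h0 : (0 : ℝ) < (N : ℝ) ^ d := by
    have : ((cube d N).card : ℝ) = (N : ℝ) ^ d := by rw [card_cube]; push_cast; rfl
    rw [← this]
    exact_mod_cast hc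
  have h1 := uniformOn_apply_finset (s := cube d N) (t := {y})
  rw [Finset.coe_singleton, Finset.inter_singleton_of_mem hy, Finset.card_singleton, card_cube]
    at h1
  rw [uniformCube, h1, ENNReal.ofReal_div_of_pos h0, ENNReal.ofReal_one, Nat.cast_one,
    ENNReal.ofReal_pow (Nat.cast_nonneg N), ENNReal.ofReal_natCast, Nat.cast_pow]

lemma uniformCube_compl : uniformCube d N ((cube d N : Set (Lattice d))ᶜ) = 0 := by
  rw [uniformCube, uniformOn_eq_zero_iff (cube d N).finite_toSet]
  exact Set.inter_compl_self _

lemma lintegral_uniformCube (f : Lattice d → ℝ≥0∞) :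
    ∫⁻ x, f x ∂(uniformCube d N) = ∑ y ∈ cube d N, f y * ENNReal.ofReal (1 / (N : ℝ) ^ d) := by
  have h1 : (uniformCube d N).restrict (cube d N : Set (Lattice d)) = uniformCube d N :=
    Measure.restrict_eq_self_of_ae_mem (mem_ae_iff.2 uniformCube_compl)
  rw [← h1, lintegral_finset]
  exact Finset.sum_congr rfl fun y hy => by rw [uniformCube_singleton hy]

lemma IsStationary.density_eq {H : Measure (Lattice d)} (hN : 0 < N) (hH : IsStationary ω N H)
    {y : Lattice d} (hy : y ∈ cube d N) :
    density N H y = ENNReal.ofReal ((H {y}).toReal * (N : ℝ) ^ d) := by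
  have := hH.isProbabilityMeasure
  have hU : IsProbabilityMeasure (uniformCube d N) :=
    isProbabilityMeasure_uniformOn (cube d N).finite_toSet ⟨y, hy⟩
  have hac : H ≪ uniformCube d N := by
    intro s hs
    have h1 : s ⊆ (cube d N : Set (Lattice d))ᶜ := by
      intro x hx hxc
      have h2 := measure_mono_null (Set.singleton_subset_iff.2 hx) hs
      rw [uniformCube_singleton hxc, ENNReal.ofReal_eq_zero] at h2
      exact h2.not_gt (by positivity)
    exact measure_mono_null h1 hH.supported
  have hL : H.HaveLebesgueDecomposition (uniformCube d N) :=
    Measure.haveLebesgueDecomposition_of_sigmaFinite H (uniformCube d N)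
  have h2 : H {y} = density N H y * uniformCube d N {y} := by
    conv_lhs => rw [← Measure.withDensity_rnDeriv_eq H (uniformCube d N) hac]
    rw [withDensity_apply _ (measurableSet_singleton y), lintegral_singleton]
    rfl
  have hne : density N H y ≠ ⊤ := by
    intro htop
    rw [htop, uniformCube_singleton hy, ENNReal.top_mul] at h2
    · exact measure_ne_top H {y} h2
    · rw [Ne, ENNReal.ofReal_eq_zero, not_le]
      positivity
  rw [h2, ENNReal.toReal_mul, uniformCube_singleton hy, ENNReal.toReal_ofReal (by positivity),
    mul_assoc, one_div_mul_cancel (by positivity), mul_one, ENNReal.ofReal_toReal hne]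

lemma eLpNorm_density_le (hd : 2 ≤ d) (hN : 2 ≤ N) (hω : IsBalanced ω)
    (hfold : ∀ x, h x = h (fold N x))
    (hg : ∀ n x, ∑ i, green (periodized ω N) i n x ≤ h x) {A : ℝ} (hA : 0 < A)
    (hsum : ∑ c ∈ cube d N, h c ^ (d + 1) ≤ A * (N : ℝ) ^ d) {H : Measure (Lattice d)}
    (hH : IsStationary ω N H) :
    eLpNorm (density N H) (ENNReal.ofReal ((d : ℝ) / ((d : ℝ) - 1))) (uniformCube d N) ≤
      ENNReal.ofReal (maxConst d A ^ (1 / (d : ℝ))) := by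
  have : Nonempty (Fin d) := ⟨⟨0, by lia⟩⟩
  have hN0 : 0 < N := by lia
  have := hH.isProbabilityMeasure
  have hd2 : (2 : ℝ) ≤ d := by exact_mod_cast hd
  have hd1 : (0 : ℝ) < (d : ℝ) - 1 := by linarith
  set r : ℝ := (d : ℝ) / ((d : ℝ) - 1) with hr
  have hr0 : 0 < r := div_pos (by linarith) hd1
  have hNd : (0 : ℝ) < (N : ℝ) ^ d := by positivity
  set φ : Lattice d → ℝ := fun y => (H {y}).toReal * (N : ℝ) ^ d with hφ
  have hφ0 : ∀ y, 0 ≤ φ y := fun y => by positivity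
  have hp1 : ∑ y ∈ cube d N, (H {y}).toReal = 1 := by
    rw [← ENNReal.toReal_sum fun y _ => measure_ne_top _ _, sum_measure_singleton,
      (prob_compl_eq_zero_iff (cube d N).measurableSet).1 hH.supported, ENNReal.toReal_one]
  have hp : ∀ y ∈ cube d N, ∑ x ∈ cube d N, (H {x}).toReal * (foldedTransition ω N x y).toReal =
      (H {y}).toReal := by
    intro y hy
    rw [← hH.stationary y hy, ENNReal.toReal_sum fun x _ =>
      ENNReal.mul_ne_top (measure_ne_top _ _) (foldedTransition_ne_top ω N x y)]
    exact Finset.sum_congr rfl fun x _ => ENNReal.toReal_mul.symm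
  set S : ℝ := ∑ y ∈ cube d N, φ y ^ r * (1 / (N : ℝ) ^ d) with hS
  have hS0 : 0 ≤ S := Finset.sum_nonneg fun y _ =>
    mul_nonneg (Real.rpow_nonneg (hφ0 y) r) (by positivity)
  have hnorm : eLpNorm (density N H) (ENNReal.ofReal r) (uniformCube d N) =
      ENNReal.ofReal (S ^ (1 / r)) := by
    rw [eLpNorm_eq_lintegral_rpow_enorm_toReal (by simpa using hr0) ENNReal.ofReal_ne_top,
      ENNReal.toReal_ofReal hr0.le, lintegral_uniformCube,
      ← ENNReal.ofReal_rpow_of_nonneg hS0 (by positivity), hS, ENNReal.ofReal_sum_of_nonneg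
        fun y _ => mul_nonneg (Real.rpow_nonneg (hφ0 y) r) (by positivity)]
    congr 1
    refine Finset.sum_congr rfl fun y hy => ?_
    rw [enorm_eq_self, hH.density_eq hN0 hy, ENNReal.ofReal_rpow_of_nonneg (hφ0 y) hr0.le,
      ENNReal.ofReal_mul (Real.rpow_nonneg (hφ0 y) r)]
  rw [hnorm]
  refine ENNReal.ofReal_le_ofReal ?_
  have hK := (maxConst_pos (d := d) hA).le
  rcases hS0.eq_or_lt with hS1 | hS1
  · rw [← hS1, Real.zero_rpow (by positivity)]
    exact Real.rpow_nonneg hK _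
  -- The extremal test function in Hölder's inequality: the estimate becomes `(N² S) ^ d ≤ K N ^ d
  -- (N ^ d S)`, that is `S ^ (d - 1) ≤ K` after cancelling `S > 0`.
  have hkey := stationary_sum_pow_le hN hω hfold hg hA hsum
    (p := fun y => (H {y}).toReal) (fun y => ENNReal.toReal_nonneg) hp1 hp
    (g := fun y => φ y ^ (1 / ((d : ℝ) - 1))) (fun y _ => Real.rpow_nonneg (hφ0 y) _)
  have h1 : ∑ y ∈ cube d N, (H {y}).toReal * φ y ^ (1 / ((d : ℝ) - 1)) = S := by
    rw [hS]
    refine Finset.sum_congr rfl fun y _ => ?_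
    have h2 : φ y ^ r = φ y * φ y ^ (1 / ((d : ℝ) - 1)) := by
      have h3 : r = 1 + 1 / ((d : ℝ) - 1) := by rw [hr]; field_simp; ring
      rw [h3, Real.rpow_add_of_nonneg (hφ0 y) zero_le_one (by positivity), Real.rpow_one]
    rw [h2, hφ]
    field_simp
  have h2 : ∑ y ∈ cube d N, (φ y ^ (1 / ((d : ℝ) - 1))) ^ d = S * (N : ℝ) ^ d := by
    rw [hS, Finset.sum_mul]
    refine Finset.sum_congr rfl fun y _ => ?_
    rw [← Real.rpow_natCast (φ y ^ (1 / ((d : ℝ) - 1))) d, ← Real.rpow_mul (hφ0 y),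
      one_div_mul_eq_div, ← hr]
    field_simp
  rw [h1, h2] at hkey
  have h3 : S ^ (d - 1) ≤ maxConst d A := by
    obtain ⟨m, rfl⟩ : ∃ m, d = m + 1 := ⟨d - 1, by lia⟩
    rw [Nat.add_sub_cancel]
    have h4 : (S * ((N : ℝ) ^ (m + 1) * (N : ℝ) ^ (m + 1))) * S ^ m ≤
        (S * ((N : ℝ) ^ (m + 1) * (N : ℝ) ^ (m + 1))) * maxConst (m + 1) A := by
      refine le_trans (le_of_eq ?_) (hkey.trans (le_of_eq ?_)) <;> ring
    exact le_of_mul_le_mul_left h4 (by positivity)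
  have h4 : S ^ (1 / r) = (S ^ (d - 1)) ^ (1 / (d : ℝ)) := by
    rw [← Real.rpow_natCast S (d - 1), ← Real.rpow_mul hS0, Nat.cast_sub (by lia), Nat.cast_one,
      hr]
    congr 1
    field_simp
  rw [h4]
  exact Real.rpow_le_rpow (by positivity) h3 (by positivity)

end

end BalancedRWRE

theorem mainTheorem4 (d : ℕ) (hd : 2 ≤ d)
    (ν : Measure (BalancedRWRE.LocalEnv d)) [IsProbabilityMeasure ν]
    (hν : ∀ᵐ ω ∂(BalancedRWRE.envLaw ν),
      BalancedRWRE.IsBalanced ω ∧ BalancedRWRE.IsGenuinelyDDimensional ω) :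
    (∀ᵐ ω ∂(BalancedRWRE.envLaw ν), ∀ᶠ N : ℕ in atTop,
      (∀ z : BalancedRWRE.Lattice d,
        ∀ᵐ X ∂(BalancedRWRE.quenchedLaw (BalancedRWRE.periodized ω N) z),
          ∀ k : ℕ, BalancedRWRE.rescaledTime X k < ⊤) ∧
      ∃ H : Measure (BalancedRWRE.Lattice d), BalancedRWRE.IsStationary ω N H) ∧
    ∃ C : ℝ≥0, ∀ᵐ ω ∂(BalancedRWRE.envLaw ν),
      ∀ H : ℕ → Measure (BalancedRWRE.Lattice d),
        (∀ᶠ N : ℕ in atTop, BalancedRWRE.IsStationary ω N (H N)) →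
        limsup (fun N : ℕ => eLpNorm (BalancedRWRE.density N (H N))
            (ENNReal.ofReal ((d : ℝ) / ((d : ℝ) - 1))) (BalancedRWRE.uniformCube d N)) atTop
          ≤ (C : ℝ≥0∞) := by
  have : Nonempty (Fin d) := ⟨⟨0, by lia⟩⟩
  obtain ⟨A, hA, hω⟩ := BalancedRWRE.exists_expectedTime ν hd (q := d + 1) (by lia) hν
  refine ⟨?_, (BalancedRWRE.maxConst d A ^ (1 / (d : ℝ))).toNNReal, ?_⟩
  · filter_upwards [hω] with ω hω
    filter_upwards [hω, eventually_gt_atTop 0] with N ⟨h, _, hfold, hg, _⟩ hN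
    exact ⟨fun z => BalancedRWRE.ae_rescaledTime_lt_top _ z fun i ε hε =>
      BalancedRWRE.exists_survival_le hN hfold hg i hε, BalancedRWRE.exists_isStationary hN hg⟩
  · filter_upwards [hω, hν] with ω hω hω' H hH
    refine limsup_le_of_le (by isBoundedDefault) ?_
    filter_upwards [hω, hH, eventually_ge_atTop 2] with N ⟨h, _, hfold, hg, hsum⟩ hHN hN
    exact BalancedRWRE.eLpNorm_density_le hd hN hω'.1 hfold hg hA hsum hHN
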